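/- Let $A=\mathbb{R}\langle x,y\rangle$ be the free associative algebra with augmentation $\epsilon:A\to\mathbb{R}$, $\epsilon(x)=\epsilon(y)=0$, let $\operatorname{tr}:A\to |A|:=A/\operatorname{span}\{ab-ba\}$ be the projection onto cyclic words, and let $L\subset A$ be the free Lie algebra on $x,y$, i.e. the Lie subalgebra of $(A,[a,b]=ab-ba)$ generated by $x$ and $y$. For $z\in\{x,y\}$ let $\partial_z:A\to A\otimes A$ be the linear map $a_1\cdots a_n\mapsto\sum_{i:\,a_i=z}a_1\cdots a_{i-1}\otimes a_{i+1}\cdots a_n$ on monomials, and put $\partial^L_z=(\operatorname{id}\otimes\epsilon)\circ\partial_z$. The divergence of a derivation $u\in\operatorname{Der}(L)$ is $\operatorname{div}(u)=\operatorname{tr}\big(\partial^L_x(u(x))+\partial^L_y(u(y))\big)\in|A|$. The elliptic Kashiwara--Vergne Lie algebra is $$\mathfrak{krv}=\{u\in\operatorname{Der}(L)\ :\ u([x,y])=0,\ \operatorname{div}(u)=0\},$$ and for integers $i,j\ge 0$ let $\mathfrak{krv}^{i,j}\subset\mathfrak{krv}$ be the subspace of those derivations that increase the $x$-degree by $i-1$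 and the $y$-degree by $j-1$. Let $F(L)$ be the quotient of $L\otimes L$ by the span of the elements $a\otimes b-b\otimes a$ and $a\otimes[b,c]-[a,b]\otimes c$ ($a,b,c\in L$), and let $\Theta(a,b)$ be the class of $a\otimes b$. To $\Gamma\in F(L)$, with image $\gamma\in|A|$ under $\Theta(a,b)\mapsto\operatorname{tr}(ab)$, corresponds the derivation $u_\Gamma$ of $L$ with $u_\Gamma(x)=\partial_y\gamma$ and $u_\Gamma(y)=-\partial_x\gamma$, where $\partial_z:|A|\to A$ is given by $\operatorname{tr}(a_1\cdots a_n)\mapsto\sum_{i:\,a_i=z}a_{i+1}\cdots a_n a_1\cdots a_{i-1}$. Write $\delta_j$ for the derivation corresponding to $\Theta(x,\operatorname{ad}_y^j(x))$. Then for every integer $j\ge 0$: 1. if $j$ is even, the derivation $\delta_j$ of $L$ exists, is non-zero, and $\mathfrak{krv}^{2,j}=\mathbb{R}\,\delta_j$; if $j$ is odd, $\mathfrak{krv}^{2,j}=0$; 2. if $j$ is even, $\mathfrak{krv}^{3,j}=0$; if $j$ is odd, $\mathfrak{krv}^{3,j}$ is finite-dimensional and $$\dim\mathfrak{krv}^{3,j}=\left\lfloor\frac{j-1}{2}\right\rfloor-\left\lfloor\frac{j-1}{3}\right\rfloor.$$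 -/

import Mathlib

open scoped TensorProduct

attribute [local instance 100] LieRing.ofAssociativeRing

noncomputable section

namespace EllipticKV

/-- The free associative algebra `A = ℝ⟨x, y⟩`; the generator `0` is `x`, the generator `1` is `y`. -/
abbrev A : Type := FreeAlgebra ℝ (Fin 2)

/-- The monomial in `A` attached to a word in the letters `0` (`x`) and `1` (`y`). -/
def mono (w : List (Fin 2)) : A := (w.map (FreeAlgebra.ι ℝ)).prod

theorem mono_append (v w : List (Fin 2)) : mono (v ++ w) = mono v * mono w := by
  simp [mono]

/-- The basis of `A` consisting of the monomials. -/
def monoBasis : Module.Basis (FreeMonoid (Fin 2)) ℝ A := FreeAlgebra.basisFreeMonoid ℝ (Fin 2)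

theorem monoBasis_apply (w : FreeMonoid (Fin 2)) : monoBasis w = mono w.toList := by
  have h : monoBasis w
      = FreeAlgebra.equivMonoidAlgebraFreeMonoid.symm
          (MonoidAlgebra.of ℝ (FreeMonoid (Fin 2)) w) := rfl
  rw [h]
  simp [FreeAlgebra.equivMonoidAlgebraFreeMonoid, mono, FreeMonoid.lift_apply]

/-- The space spanned by the monomials with exactly `p` letters `x` and `q` letters `y`
(zero as soon as `p < 0` or `q < 0`). -/
def bideg (p q : ℤ) : Submodule ℝ A :=
  Submodule.span ℝ {a | ∃ w : List (Fin 2), (w.count 0 : ℤ) = p ∧ (w.count 1 : ℤ) = q ∧ a = mono w}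

/-- The span of the commutators `ab - ba` in `A`. -/
def commSpan : Submodule ℝ A := Submodule.span ℝ {c | ∃ a b : A, c = a * b - b * a}

/-- The trace space of cyclic words. -/
abbrev Tr : Type := A ⧸ commSpan

/-- The projection `A → Tr`. -/
def tr : A →ₗ[ℝ] Tr := commSpan.mkQ

/-- For a word `a₁ ⋯ aₙ`, the sum over all `i` with `aᵢ = z` of
`a₁ ⋯ aᵢ₋₁ ⊗ aᵢ₊₁ ⋯ aₙ`. -/
def partialWord (z : Fin 2) (w : List (Fin 2)) : A ⊗[ℝ] A :=
  ∑ i ∈ Finset.range w.length,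
    if w[i]? = some z then mono (w.take i) ⊗ₜ[ℝ] mono (w.drop (i + 1)) else 0

/-- `∂_z : A → A ⊗ A`, the linear extension of `partialWord`. -/
def partialA (z : Fin 2) : A →ₗ[ℝ] A ⊗[ℝ] A :=
  monoBasis.constr ℝ fun w => partialWord z w.toList

/-- The augmentation `ε : A → ℝ`, picking out the constant term. -/
def aug : A →ₐ[ℝ] ℝ := FreeAlgebra.lift ℝ fun _ => 0

/-- `∂^L_z = (id ⊗ ε) ∘ ∂_z : A → A`, used on elements of the free Lie algebra. -/
def partialL (z : Fin 2) : A →ₗ[ℝ] A :=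
  (TensorProduct.rid ℝ A).toLinearMap ∘ₗ aug.toLinearMap.lTensor A ∘ₗ partialA z

/-- For a word `a₁ ⋯ aₙ`, the sum over all `i` with `aᵢ = z` of `aᵢ₊₁ ⋯ aₙ a₁ ⋯ aᵢ₋₁`. -/
def cycWord (z : Fin 2) (w : List (Fin 2)) : A :=
  ∑ i ∈ Finset.range w.length,
    if w[i]? = some z then mono (w.drop (i + 1) ++ w.take i) else 0

/-- The cyclic partial derivative on representatives, the linear extension of `cycWord`. -/
def cycPartial (z : Fin 2) : A →ₗ[ℝ] A :=
  monoBasis.constr ℝ fun w => cycWord z w.toList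

theorem cycWord_append (z : Fin 2) (v w : List (Fin 2)) :
    cycWord z (v ++ w) =
      (∑ i ∈ Finset.range v.length,
        if v[i]? = some z then mono (v.drop (i + 1) ++ w ++ v.take i) else 0) +
      ∑ i ∈ Finset.range w.length,
        if w[i]? = some z then mono (w.drop (i + 1) ++ v ++ w.take i) else 0 := by
  rw [cycWord, List.length_append, Finset.sum_range_add]
  congr 1
  · refine Finset.sum_congr rfl fun i hi => ?_
    have hi' : i < v.length := Finset.mem_range.1 hi
    rw [List.getElem?_append_left hi', List.drop_append_of_le_length (by omega),
      List.take_append_of_le_length (by omega)]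
  · refine Finset.sum_congr rfl fun i _ => ?_
    rw [List.getElem?_append_right (by omega), List.drop_append, List.take_append,
      List.drop_of_length_le (by omega), List.take_of_length_le (by omega)]
    simp [Nat.add_assoc]

theorem cycPartial_basis_mul (z : Fin 2) (v w : FreeMonoid (Fin 2)) :
    cycPartial z (monoBasis v * monoBasis w) = cycWord z (v.toList ++ w.toList) := by
  have h : monoBasis v * monoBasis w = monoBasis (v * w) := by
    simp [monoBasis_apply, mono_append, FreeMonoid.toList_mul]
  rw [h, cycPartial, Module.Basis.constr_basis, FreeMonoid.toList_mul]

theorem cycPartial_mul_comm (z : Fin 2) (a b : A) :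
    cycPartial z (a * b) = cycPartial z (b * a) := by
  have h : (LinearMap.mul ℝ A).compr₂ (cycPartial z)
      = ((LinearMap.mul ℝ A).flip).compr₂ (cycPartial z) := by
    refine monoBasis.ext fun v => monoBasis.ext fun w => ?_
    simp only [LinearMap.compr₂_apply, LinearMap.flip_apply, LinearMap.mul_apply']
    rw [cycPartial_basis_mul, cycPartial_basis_mul, cycWord_append, cycWord_append, add_comm]
  exact LinearMap.congr_fun (LinearMap.congr_fun h a) b

theorem commSpan_le_ker (z : Fin 2) : commSpan ≤ LinearMap.ker (cycPartial z) := by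
  refine Submodule.span_le.2 ?_
  rintro _ ⟨a, b, rfl⟩
  simp [cycPartial_mul_comm z a b]

/-- The partial derivative `Tr → A` of cyclic words. -/
def partialTr (z : Fin 2) : Tr →ₗ[ℝ] A := commSpan.liftQ (cycPartial z) (commSpan_le_ker z)

/-- The free Lie algebra on `x, y`, as the Lie subalgebra of `A` generated by `x` and `y`. -/
def freeLie : LieSubalgebra ℝ A := LieSubalgebra.lieSpan ℝ A (Set.range (FreeAlgebra.ι ℝ))

abbrev L : Type := freeLie

/-- The generators of the free Lie algebra. -/
def gen (z : Fin 2) : L := ⟨FreeAlgebra.ι ℝ z, LieSubalgebra.subset_lieSpan ⟨z, rfl⟩⟩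

abbrev x : L := gen 0

abbrev y : L := gen 1

/-- The relations `a ⊗ b = b ⊗ a` and `a ⊗ [b, c] = [a, b] ⊗ c` in `L ⊗ L`. -/
def treeRel : Submodule ℝ (L ⊗[ℝ] L) :=
  Submodule.span ℝ ({t | ∃ a b : L, t = a ⊗ₜ[ℝ] b - b ⊗ₜ[ℝ] a} ∪
    {t | ∃ a b c : L, t = a ⊗ₜ[ℝ] ⁅b, c⁆ - ⁅a, b⁆ ⊗ₜ[ℝ] c})

/-- The space `F(L)` of (unrooted) Lie trees. -/
abbrev FL : Type := (L ⊗[ℝ] L) ⧸ treeRel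

/-- `Θ(a, b)`, the class of `a ⊗ b` in `F(L)`. -/
def theta (a b : L) : FL := treeRel.mkQ (a ⊗ₜ[ℝ] b)

/-- The linear map `L ⊗ L → Tr`, `a ⊗ b ↦ tr (ab)`. -/
def pairTr : L ⊗[ℝ] L →ₗ[ℝ] Tr :=
  TensorProduct.lift
    (((LinearMap.mul ℝ A).compl₁₂ freeLie.toSubmodule.subtype freeLie.toSubmodule.subtype).compr₂ tr)

theorem pairTr_tmul (a b : L) : pairTr (a ⊗ₜ[ℝ] b) = tr ((a : A) * (b : A)) := rfl

theorem tr_mul_comm (a b : A) : tr (a * b) = tr (b * a) :=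
  (Submodule.Quotient.eq _).2 (Submodule.subset_span ⟨a, b, rfl⟩)

theorem treeRel_le_ker : treeRel ≤ LinearMap.ker pairTr := by
  refine Submodule.span_le.2 ?_
  rintro _ (⟨a, b, rfl⟩ | ⟨a, b, c, rfl⟩)
  · simp [pairTr_tmul, tr_mul_comm (a : A) (b : A)]
  · have h := tr_mul_comm ((a : A) * (c : A)) (b : A)
    simp only [SetLike.mem_coe, LinearMap.mem_ker, map_sub, pairTr_tmul, LieSubalgebra.coe_bracket,
      LieRing.of_associative_ring_bracket, mul_sub, sub_mul, ← mul_assoc] at h ⊢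
    rw [h]
    abel

/-- The natural map `F(L) → Tr`, `Θ(a, b) ↦ tr (ab)`. -/
def treeToTr : FL →ₗ[ℝ] Tr := treeRel.liftQ pairTr treeRel_le_ker

/-- `Der(L)`. -/
abbrev Der : Type := LieDerivation ℝ L L

/-- `u` is the derivation `u_Γ` attached to the tree `Γ`, that is,
`u(x) = ∂_y Γ` and `u(y) = -∂_x Γ`. As `x, y` generate `L`, at most one `u` has this property. -/
def IsDerivationOfTree (Γ : FL) (u : Der) : Prop :=
  (u x : A) = partialTr 1 (treeToTr Γ) ∧ (u y : A) = -partialTr 0 (treeToTr Γ)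

/-- The tree `δ_j = Θ(x, ad_y^j (x))`. -/
def deltaTree (j : ℕ) : FL := theta x (((LieAlgebra.ad ℝ L y) ^ j) x)

/-- The divergence `div(u) = tr (∂^L_x (u(x)) + ∂^L_y (u(y)))`. -/
def divergence (u : Der) : Tr := tr (partialL 0 (u x : A) + partialL 1 (u y : A))

/-- The elliptic Kashiwara–Vergne Lie algebra (as a subspace of `Der(L)`): the derivations that
annihilate `[x, y]` and have divergence zero. -/
def krv : Submodule ℝ Der where
  carrier := {u | u ⁅x, y⁆ = 0 ∧ divergence u = 0}
  zero_mem' := by simp [divergence]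
  add_mem' := by
    rintro u v ⟨hu, hu'⟩ ⟨hv, hv'⟩
    refine ⟨by rw [LieDerivation.add_apply, hu, hv, add_zero], ?_⟩
    have h : divergence (u + v) = divergence u + divergence v := by
      simp only [divergence, LieDerivation.add_apply, AddMemClass.coe_add, map_add]
      abel
    rw [h, hu', hv', add_zero]
  smul_mem' := by
    rintro c u ⟨hu, hu'⟩
    refine ⟨by rw [LieDerivation.smul_apply, hu, smul_zero], ?_⟩
    have h : divergence (c • u) = c • divergence u := by
      simp only [divergence, LieDerivation.smul_apply, SetLike.val_smul, map_smul, map_add,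
        smul_add]
    rw [h, hu', smul_zero]

/-- The derivations of `L` that increase the `x`-degree by `i - 1` and the `y`-degree by `j - 1`. -/
def derBideg (i j : ℕ) : Submodule ℝ Der where
  carrier := {u | ∀ (p q : ℤ) (a : L), (a : A) ∈ bideg p q →
    (u a : A) ∈ bideg (p + (i - 1)) (q + (j - 1))}
  zero_mem' := fun _ _ _ _ => by simp
  add_mem' := fun hu hv p q a ha => by
    simpa using add_mem (hu p q a ha) (hv p q a ha)
  smul_mem' := fun c u hu p q a ha => by
    simpa using Submodule.smul_mem _ c (hu p q a ha)

/-- The bigraded piece `krv^{i,j}`. -/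
def krvBideg (i j : ℕ) : Submodule ℝ Der := krv ⊓ derBideg i j

end EllipticKV

end

noncomputable section

namespace EllipticKV

/-! ### Monomials and bidegrees -/

/-! Encode a word y^{p₀} x y^{p₁} ⋯ x y^{pₙ} of x-degree n by the monomial Y₀^{p₀} ⋯ Yₙ^{pₙ}. This
encoding, `ev n`, is faithful in fixed x-degree (`eq_zero_of_ev_X_eq_zero`). It turns [·, y] into
multiplication by Yₙ − Y₀ and [x, ·] into a difference of shifts. So u([x, y]) = 0 becomes the
identity `ev_apply_x_mul` between the polynomials of u(x) and u(y). It shows that u is determined by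
u(y) in positive x-degree i, and, at Yₙ₊₁ = Y₀, that the polynomial f of u(y) is cyclically
invariant.

Lie elements have special polynomials. In x-degree one they depend only on Y₀ − Y₁, so bidegree (1,
j) is the line through ad_y^j(x). In x-degree two they depend only on the differences s = Y₀ − Y₁
and t = Y₁ − Y₂, and are antisymmetric in them.

For i = 2, f = c(Y₀ − Y₁)^j. Cyclic invariance forces c = 0 for odd j; for even j the derivation δ_j
realises c = −2, and the divergence vanishes automatically.

For i = 3, antisymmetry and cyclic invariance say that f is a binary form of sign type under S₃
permuting s, t, −s − t. The divergence D satisfies p·D(p, q) = f(q, p, 0) − f(p, q, 0)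
(`mul_ev_two_divergence`), while f(q, p, 0) = −(−1)^j f(p, q, 0). For odd j it vanishes; for even j
its vanishing as a cyclic word forces f = 0. For odd j every sign form g occurs, since a suitable
tree gives −6g. Sign forms are counted by rank–nullity: multiplication by st(s + t) raises the
degree by three, and its image is the kernel of evaluation at (1, 0). -/

theorem mono_nil : mono [] = 1 := rfl

theorem mono_cons (c : Fin 2) (w : List (Fin 2)) :
    mono (c :: w) = FreeAlgebra.ι ℝ c * mono w := by
  simp [mono]

theorem mono_singleton (c : Fin 2) : mono [c] = FreeAlgebra.ι ℝ c := by
  simp [mono]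

theorem monoBasis_ofList (w : List (Fin 2)) : monoBasis (FreeMonoid.ofList w) = mono w := by
  rw [monoBasis_apply, FreeMonoid.toList_ofList]

theorem constr_mono {M : Type*} [AddCommGroup M] [Module ℝ M] (f : List (Fin 2) → M)
    (w : List (Fin 2)) : monoBasis.constr ℝ (fun v => f v.toList) (mono w) = f w := by
  rw [← monoBasis_ofList, Module.Basis.constr_basis, FreeMonoid.toList_ofList]

theorem hom_ext_mono {M : Type*} [AddCommGroup M] [Module ℝ M] {f g : A →ₗ[ℝ] M}
    (h : ∀ w, f (mono w) = g (mono w)) : f = g :=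
  monoBasis.ext fun w => by simpa only [monoBasis_apply] using h w.toList

theorem mono_induction {p : A → Prop} (mono : ∀ w, p (mono w))
    (add : ∀ a b, p a → p b → p (a + b)) (smul : ∀ (c : ℝ) a, p a → p (c • a)) (a : A) : p a := by
  have ha : a ∈ Submodule.span ℝ (Set.range monoBasis) := monoBasis.mem_span a
  induction ha using Submodule.span_induction with
  | mem b hb =>
    obtain ⟨w, rfl⟩ := hb
    rw [monoBasis_apply]
    exact mono _
  | zero => simpa using smul 0 _ (mono [])
  | add a b _ _ ha hb => exact add a b ha hb
  | smul c a _ ha => exact smul c a ha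

theorem mono_mem_bideg {p q : ℤ} {w : List (Fin 2)} (hp : (w.count 0 : ℤ) = p)
    (hq : (w.count 1 : ℤ) = q) : mono w ∈ bideg p q :=
  Submodule.subset_span ⟨w, hp, hq, rfl⟩

theorem map_mem_of_mem_bideg {M : Type*} [AddCommGroup M] [Module ℝ M] (f : A →ₗ[ℝ] M)
    (N : Submodule ℝ M) {p q : ℤ}
    (h : ∀ w : List (Fin 2), (w.count 0 : ℤ) = p → (w.count 1 : ℤ) = q → f (mono w) ∈ N)
    {a : A} (ha : a ∈ bideg p q) : f a ∈ N := by
  have : bideg p q ≤ N.comap f := by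
    refine Submodule.span_le.2 ?_
    rintro _ ⟨w, hp, hq, rfl⟩
    exact h w hp hq
  exact this ha

theorem eq_of_mem_bideg {M : Type*} [AddCommGroup M] [Module ℝ M] (f g : A →ₗ[ℝ] M) {p q : ℤ}
    (h : ∀ w : List (Fin 2), (w.count 0 : ℤ) = p → (w.count 1 : ℤ) = q → f (mono w) = g (mono w))
    {a : A} (ha : a ∈ bideg p q) : f a = g a := by
  have := map_mem_of_mem_bideg (f - g) ⊥ (fun w hp hq => by simp [h w hp hq]) ha
  simpa [sub_eq_zero] using this

theorem mul_mem_bideg {p q p' q' : ℤ} {a b : A} (ha : a ∈ bideg p q) (hb : b ∈ bideg p' q') :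
    a * b ∈ bideg (p + p') (q + q') := by
  refine map_mem_of_mem_bideg (LinearMap.mulRight ℝ b) _ (fun v hp hq => ?_) ha
  refine map_mem_of_mem_bideg (LinearMap.mulLeft ℝ (mono v)) _ (fun w hp' hq' => ?_) hb
  rw [LinearMap.mulLeft_apply, ← mono_append]
  exact mono_mem_bideg (by simp [hp, hp']) (by simp [hq, hq'])

theorem lie_mem_bideg {p q p' q' : ℤ} {a b : A} (ha : a ∈ bideg p q) (hb : b ∈ bideg p' q') :
    ⁅a, b⁆ ∈ bideg (p + p') (q + q') := by
  rw [LieRing.of_associative_ring_bracket]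
  refine sub_mem (mul_mem_bideg ha hb) ?_
  rw [add_comm p, add_comm q]
  exact mul_mem_bideg hb ha

theorem ι_zero_mem_bideg : FreeAlgebra.ι ℝ (0 : Fin 2) ∈ bideg 1 0 := by
  rw [← mono_singleton]
  exact mono_mem_bideg (by simp) (by simp)

theorem ι_one_mem_bideg : FreeAlgebra.ι ℝ (1 : Fin 2) ∈ bideg 0 1 := by
  rw [← mono_singleton]
  exact mono_mem_bideg (by simp) (by simp)

/-! ### Derivations of the free algebra and of the free Lie algebra -/

/-- The value on a word of the derivation of `A` with values `f` on the generators. -/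
def derivWord (f : Fin 2 → A) : List (Fin 2) → A
  | [] => 0
  | c :: w => f c * mono w + FreeAlgebra.ι ℝ c * derivWord f w

/-- The derivation of `A` with values `f` on the generators. -/
def deriv (f : Fin 2 → A) : A →ₗ[ℝ] A := monoBasis.constr ℝ fun w => derivWord f w.toList

theorem deriv_mono (f : Fin 2 → A) (w : List (Fin 2)) : deriv f (mono w) = derivWord f w :=
  constr_mono _ w

theorem derivWord_append (f : Fin 2 → A) (v w : List (Fin 2)) :
    derivWord f (v ++ w) = derivWord f v * mono w + mono v * derivWord f w := by
  induction v with
  | nil => simp [derivWord, mono_nil]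
  | cons c v ih => simp [derivWord, ih, mono_append, mono_cons, mul_add, add_mul, mul_assoc,
      add_assoc]

theorem deriv_mul (f : Fin 2 → A) (a b : A) : deriv f (a * b) = deriv f a * b + a * deriv f b := by
  induction a using mono_induction with
  | add a a' h h' => simp only [add_mul, map_add, h, h']; abel
  | smul c a h => simp only [smul_mul_assoc, map_smul, h, smul_add]
  | mono v =>
    induction b using mono_induction with
    | add a a' h h' => simp only [mul_add, map_add, h, h']; abel
    | smul c a h => simp only [mul_smul_comm, map_smul, h, smul_add]
    | mono w => rw [← mono_append, deriv_mono, derivWord_append, deriv_mono, deriv_mono]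

theorem deriv_ι (f : Fin 2 → A) (c : Fin 2) : deriv f (FreeAlgebra.ι ℝ c) = f c := by
  rw [← mono_singleton, deriv_mono]
  simp [derivWord, mono_nil]

theorem deriv_lie (f : Fin 2 → A) (a b : A) : deriv f ⁅a, b⁆ = ⁅deriv f a, b⁆ + ⁅a, deriv f b⁆ := by
  simp only [LieRing.of_associative_ring_bracket, map_sub, deriv_mul]
  abel

theorem deriv_mem_bideg {f : Fin 2 → A} {r s : ℤ} (hx : f 0 ∈ bideg (1 + r) s)
    (hy : f 1 ∈ bideg r (1 + s)) {p q : ℤ} {a : A} (ha : a ∈ bideg p q) :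
    deriv f a ∈ bideg (p + r) (q + s) := by
  refine map_mem_of_mem_bideg _ _ (fun w hp hq => ?_) ha
  rw [deriv_mono]
  induction w generalizing p q a with
  | nil => exact zero_mem _
  | cons c w ih =>
    have hw : mono w ∈ bideg (w.count 0) (w.count 1) := mono_mem_bideg rfl rfl
    obtain rfl | rfl : c = 0 ∨ c = 1 := by omega
    · simp only [List.count_cons_self, Nat.cast_add, Nat.cast_one] at hp
      simp only [List.count_cons, Nat.cast_add] at hq
      refine add_mem ?_ ?_
      · convert mul_mem_bideg hx hw using 2
        · rw [← hp]; ring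
        · rw [← hq]; simp [add_comm]
      · convert mul_mem_bideg ι_zero_mem_bideg (ih hw rfl rfl) using 2
        · rw [← hp]; ring
        · rw [← hq]; simp
    · simp only [List.count_cons, Nat.cast_add] at hp
      simp only [List.count_cons_self, Nat.cast_add, Nat.cast_one] at hq
      refine add_mem ?_ ?_
      · convert mul_mem_bideg hy hw using 2
        · rw [← hp]; simp [add_comm]
        · rw [← hq]; ring
      · convert mul_mem_bideg ι_one_mem_bideg (ih hw rfl rfl) using 2
        · rw [← hp]; simp
        · rw [← hq]; ring

theorem ι_mem_freeLie (c : Fin 2) : FreeAlgebra.ι ℝ c ∈ freeLie :=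
  LieSubalgebra.subset_lieSpan ⟨c, rfl⟩

theorem freeLie_induction {p : (a : A) → a ∈ freeLie → Prop}
    (gen : ∀ c, p (FreeAlgebra.ι ℝ c) (ι_mem_freeLie c))
    (add : ∀ a b ha hb, p a ha → p b hb → p (a + b) (add_mem ha hb))
    (smul : ∀ (c : ℝ) a ha, p a ha → p (c • a) (freeLie.smul_mem c ha))
    (lie : ∀ a b ha hb, p a ha → p b hb → p ⁅a, b⁆ (freeLie.lie_mem ha hb))
    {a : A} (ha : a ∈ freeLie) : p a ha := by
  induction ha using LieSubalgebra.lieSpan_induction with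
  | mem a h => obtain ⟨c, rfl⟩ := h; exact gen c
  | zero =>
    have := smul 0 _ _ (gen 0)
    simpa only [zero_smul] using this
  | add a b ha hb h h' => exact add a b ha hb h h'
  | smul c a ha h => exact smul c a ha h
  | lie a b ha hb h h' => exact lie a b ha hb h h'

theorem deriv_mem_freeLie (f : Fin 2 → L) {a : A} (ha : a ∈ freeLie) :
    deriv (fun c => f c) a ∈ freeLie := by
  induction ha using freeLie_induction with
  | gen c => rw [deriv_ι]; exact (f c).2
  | add a b _ _ h h' => rw [map_add]; exact add_mem h h'
  | smul c a _ h => rw [map_smul]; exact freeLie.smul_mem c h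
  | lie a b ha hb h h' =>
    rw [deriv_lie]
    exact add_mem (freeLie.lie_mem h hb) (freeLie.lie_mem ha h')

/-- The derivation of `L` with values `f` on the generators. -/
def lieDeriv (f : Fin 2 → L) : Der where
  toLinearMap := ((deriv fun c => f c) ∘ₗ freeLie.toSubmodule.subtype).codRestrict
    freeLie.toSubmodule fun a => deriv_mem_freeLie f a.2
  leibniz' a b := by
    apply Subtype.ext
    change deriv _ ⁅(a : A), (b : A)⁆ = ⁅(a : A), deriv _ (b : A)⁆ - ⁅(b : A), deriv _ (a : A)⁆
    rw [deriv_lie, ← lie_skew (b : A)]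
    abel

theorem coe_lieDeriv (f : Fin 2 → L) (a : L) : (lieDeriv f a : A) = deriv (fun c => f c) a := rfl

theorem lieDeriv_gen (f : Fin 2 → L) (c : Fin 2) : lieDeriv f (gen c) = f c :=
  Subtype.ext (by rw [coe_lieDeriv]; exact deriv_ι _ c)

theorem der_ext {u v : Der} (hx : u x = v x) (hy : u y = v y) : u = v := by
  have key : ∀ a (ha : a ∈ freeLie), u ⟨a, ha⟩ = v ⟨a, ha⟩ := by
    intro a ha
    induction ha using freeLie_induction with
    | gen c =>
      obtain rfl | rfl : c = 0 ∨ c = 1 := by omega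
      exacts [hx, hy]
    | add a b ha hb h h' =>
      have : (⟨a + b, add_mem ha hb⟩ : L) = ⟨a, ha⟩ + ⟨b, hb⟩ := rfl
      rw [this, map_add, map_add, h, h']
    | smul c a ha h =>
      have : (⟨c • a, freeLie.smul_mem c ha⟩ : L) = c • ⟨a, ha⟩ := rfl
      rw [this, map_smul, map_smul, h]
    | lie a b ha hb h h' =>
      have : (⟨⁅a, b⁆, freeLie.lie_mem ha hb⟩ : L) = ⁅(⟨a, ha⟩ : L), (⟨b, hb⟩ : L)⁆ := rfl
      rw [this, u.apply_lie_eq_sub, v.apply_lie_eq_sub, h, h']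
  exact LieDerivation.ext fun a : L => key a a.2

theorem eq_lieDeriv (u : Der) : u = lieDeriv fun c => u (gen c) :=
  der_ext (lieDeriv_gen (fun c => u (gen c)) 0).symm (lieDeriv_gen (fun c => u (gen c)) 1).symm

theorem mem_derBideg_iff {i j : ℕ} {u : Der} :
    u ∈ derBideg i j ↔ (u x : A) ∈ bideg i ((j : ℤ) - 1) ∧ (u y : A) ∈ bideg ((i : ℤ) - 1) j := by
  constructor
  · intro hu
    have hx := hu 1 0 x ι_zero_mem_bideg
    have hy := hu 0 1 y ι_one_mem_bideg
    rw [add_sub_cancel, zero_add] at hx hy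
    exact ⟨hx, hy⟩
  · rintro ⟨hx, hy⟩ p q a ha
    rw [eq_lieDeriv u, coe_lieDeriv]
    refine deriv_mem_bideg ?_ ?_ ha
    · rw [add_sub_cancel]; exact hx
    · rw [add_sub_cancel]; exact hy

theorem apply_lie_eq_zero_iff (u : Der) :
    u ⁅x, y⁆ = 0 ↔
      ⁅(u x : A), FreeAlgebra.ι ℝ (1 : Fin 2)⁆ + ⁅FreeAlgebra.ι ℝ (0 : Fin 2), (u y : A)⁆ = 0 := by
  rw [LieDerivation.apply_lie_eq_add, add_comm, Subtype.ext_iff]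
  exact Iff.rfl

/-! ### Cyclic derivatives -/

/-- For a word `w = a₁ ⋯ aₙ`, the map sending `b` to the sum over all `i` with `aᵢ = z` of
`aᵢ₊₁ ⋯ aₙ b a₁ ⋯ aᵢ₋₁`. -/
def sandwichWord (z : Fin 2) : List (Fin 2) → A →ₗ[ℝ] A
  | [] => 0
  | c :: w => (if c = z then LinearMap.mulLeft ℝ (mono w) else 0) +
      sandwichWord z w ∘ₗ LinearMap.mulRight ℝ (FreeAlgebra.ι ℝ c)

/-- The linear extension of `sandwichWord`: if `∂_z a = ∑ a' ⊗ a''`, then `sandwich z a b` is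
`∑ a'' b a'`. -/
def sandwich (z : Fin 2) : A →ₗ[ℝ] A →ₗ[ℝ] A :=
  monoBasis.constr ℝ fun w => sandwichWord z w.toList

theorem sandwich_mono (z : Fin 2) (w : List (Fin 2)) : sandwich z (mono w) = sandwichWord z w :=
  constr_mono _ w

theorem sandwichWord_cons (z c : Fin 2) (w : List (Fin 2)) (b : A) :
    sandwichWord z (c :: w) b =
      (if c = z then mono w * b else 0) + sandwichWord z w (b * FreeAlgebra.ι ℝ c) := by
  rw [sandwichWord]
  split_ifs <;> simp

theorem sandwichWord_append (z : Fin 2) (v w : List (Fin 2)) (b : A) :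
    sandwichWord z (v ++ w) b = sandwichWord z v (mono w * b) + sandwichWord z w (b * mono v) := by
  induction v generalizing b with
  | nil => simp [sandwichWord, mono_nil]
  | cons c v ih =>
    simp only [List.cons_append, sandwichWord_cons, ih, mono_append, mono_cons, mul_assoc,
      add_assoc]

theorem sandwich_mul (z : Fin 2) (a a' b : A) :
    sandwich z (a * a') b = sandwich z a (a' * b) + sandwich z a' (b * a) := by
  induction a using mono_induction with
  | add a c h h' => simp only [add_mul, mul_add, map_add, LinearMap.add_apply, h, h']; abel
  | smul c a h => simp only [smul_mul_assoc, mul_smul_comm, map_smul, LinearMap.smul_apply, h,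
      smul_add]
  | mono v =>
    induction a' using mono_induction with
    | add a c h h' => simp only [add_mul, mul_add, map_add, LinearMap.add_apply, h, h']; abel
    | smul c a h => simp only [smul_mul_assoc, mul_smul_comm, map_smul, LinearMap.smul_apply, h,
        smul_add]
    | mono w => rw [← mono_append, sandwich_mono, sandwichWord_append, sandwich_mono, sandwich_mono]

theorem sandwich_ι (z c : Fin 2) (b : A) :
    sandwich z (FreeAlgebra.ι ℝ c) b = if c = z then b else 0 := by
  rw [← mono_singleton, sandwich_mono, sandwichWord_cons]
  simp [sandwichWord, mono_nil]

/-- Moves brackets from the first argument to the second. Induction on Lie elements then stays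
inside `freeLie`, which is why cyclic derivatives of tr(ab) with a, b Lie are again Lie. -/
theorem sandwich_lie (z : Fin 2) (a a' b : A) :
    sandwich z ⁅a, a'⁆ b = sandwich z a ⁅a', b⁆ + sandwich z a' ⁅b, a⁆ := by
  simp only [LieRing.of_associative_ring_bracket, map_sub, LinearMap.sub_apply, sandwich_mul]
  abel

theorem sandwich_mem_freeLie (z : Fin 2) {a b : A} (ha : a ∈ freeLie) (hb : b ∈ freeLie) :
    sandwich z a b ∈ freeLie := by
  induction ha using freeLie_induction generalizing b with
  | gen c =>
    rw [sandwich_ι]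
    split_ifs
    exacts [hb, zero_mem _]
  | add a a' _ _ h h' => rw [map_add, LinearMap.add_apply]; exact add_mem (h hb) (h' hb)
  | smul c a _ h => rw [map_smul, LinearMap.smul_apply]; exact freeLie.smul_mem c (h hb)
  | lie a a' ha ha' h h' =>
    rw [sandwich_lie]
    exact add_mem (h (freeLie.lie_mem ha' hb)) (h' (freeLie.lie_mem hb ha))

theorem sandwichWord_eq_sum (z : Fin 2) (w : List (Fin 2)) (b : A) :
    sandwichWord z w b = ∑ i ∈ Finset.range w.length,
      if w[i]? = some z then mono (w.drop (i + 1)) * b * mono (w.take i) else 0 := by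
  induction w generalizing b with
  | nil => simp [sandwichWord]
  | cons c w ih =>
    rw [sandwichWord_cons, ih, List.length_cons, Finset.sum_range_succ', add_comm]
    simp [mono_cons, mono_nil, mul_assoc]

theorem cycPartial_eq (z : Fin 2) (a : A) : cycPartial z a = sandwich z a 1 := by
  suffices cycPartial z = (sandwich z).flip 1 by rw [this, LinearMap.flip_apply]
  refine hom_ext_mono fun w => ?_
  rw [LinearMap.flip_apply, sandwich_mono, sandwichWord_eq_sum, cycPartial, constr_mono, cycWord]
  simp [mono_append]

theorem cycPartial_mul (z : Fin 2) (a b : A) :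
    cycPartial z (a * b) = sandwich z a b + sandwich z b a := by
  rw [cycPartial_eq, sandwich_mul, mul_one, one_mul]

/-- For a word a₁ ⋯ aₙ the i-th letter contributes aᵢ ⋯ aₙ b a₁ ⋯ aᵢ₋₁ − aᵢ₊₁ ⋯ aₙ b a₁ ⋯ aᵢ, and
the sum telescopes. The case b = 1 is the reason u_Γ kills [x, y]. -/
theorem sum_ι_mul_sandwich_sub (a b : A) :
    ∑ z, (FreeAlgebra.ι ℝ z * sandwich z a b - sandwich z a b * FreeAlgebra.ι ℝ z) =
      a * b - b * a := by
  induction a using mono_induction with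
  | add a a' h h' =>
    simp only [map_add, LinearMap.add_apply, mul_add, add_mul, add_sub_add_comm,
      Finset.sum_add_distrib, h, h']
  | smul c a h =>
    simp only [map_smul, LinearMap.smul_apply, mul_smul_comm, smul_mul_assoc, ← smul_sub,
      ← Finset.smul_sum, h]
  | mono w =>
    simp only [sandwich_mono]
    induction w generalizing b with
    | nil => simp [sandwichWord, mono_nil]
    | cons c w ih =>
      simp only [sandwichWord_cons, mul_add, add_mul, add_sub_add_comm, Finset.sum_add_distrib, ih,
        mul_ite, ite_mul, mul_zero, zero_mul, Finset.sum_sub_distrib, Finset.sum_ite_eq,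
        Finset.mem_univ, if_true, mono_cons, mul_assoc]
      abel

theorem lie_cycPartial_add_lie (a : A) :
    ⁅cycPartial 1 a, FreeAlgebra.ι ℝ (1 : Fin 2)⁆ +
      ⁅FreeAlgebra.ι ℝ (0 : Fin 2), -cycPartial 0 a⁆ = 0 := by
  have h := sum_ι_mul_sandwich_sub a 1
  simp only [← cycPartial_eq, Fin.sum_univ_two, mul_one, one_mul, sub_self] at h
  simp only [LieRing.of_associative_ring_bracket, mul_neg, neg_mul, ← neg_eq_zero.2 h]
  abel

theorem cycPartial_mul_mem_freeLie (z : Fin 2) {a b : A} (ha : a ∈ freeLie) (hb : b ∈ freeLie) :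
    cycPartial z (a * b) ∈ freeLie := by
  rw [cycPartial_mul]
  exact add_mem (sandwich_mem_freeLie z ha hb) (sandwich_mem_freeLie z hb ha)

theorem cycPartial_zero_mem_bideg {p q : ℤ} {a : A} (ha : a ∈ bideg p q) :
    cycPartial 0 a ∈ bideg (p - 1) q := by
  refine map_mem_of_mem_bideg _ _ (fun w hp hq => ?_) ha
  rw [cycPartial, constr_mono]
  refine sum_mem fun i _ => ?_
  split_ifs with h
  · obtain ⟨hi, h⟩ := List.getElem?_eq_some_iff.1 h
    have hw := List.take_append_drop i w
    rw [List.drop_eq_getElem_cons hi, h] at hw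
    rw [← hw] at hp hq
    refine mono_mem_bideg ?_ ?_ <;> simp [List.count_append] at hp hq ⊢ <;> omega
  · exact zero_mem _

theorem cycPartial_one_mem_bideg {p q : ℤ} {a : A} (ha : a ∈ bideg p q) :
    cycPartial 1 a ∈ bideg p (q - 1) := by
  refine map_mem_of_mem_bideg _ _ (fun w hp hq => ?_) ha
  rw [cycPartial, constr_mono]
  refine sum_mem fun i _ => ?_
  split_ifs with h
  · obtain ⟨hi, h⟩ := List.getElem?_eq_some_iff.1 h
    have hw := List.take_append_drop i w
    rw [List.drop_eq_getElem_cons hi, h] at hw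
    rw [← hw] at hp hq
    refine mono_mem_bideg ?_ ?_ <;> simp [List.count_append] at hp hq ⊢ <;> omega
  · exact zero_mem _

/-- The derivation attached to the cyclic word `tr (ab)` for Lie elements `a` and `b`. -/
def hamDeriv (a b : L) : Der :=
  lieDeriv ![⟨_, cycPartial_mul_mem_freeLie 1 a.2 b.2⟩,
    -⟨_, cycPartial_mul_mem_freeLie 0 a.2 b.2⟩]

theorem coe_hamDeriv_x (a b : L) : (hamDeriv a b x : A) = cycPartial 1 ((a : A) * b) := by
  rw [hamDeriv, lieDeriv_gen]; rfl

theorem coe_hamDeriv_y (a b : L) : (hamDeriv a b y : A) = -cycPartial 0 ((a : A) * b) := by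
  rw [hamDeriv, lieDeriv_gen]; rfl

theorem isDerivationOfTree_hamDeriv (a b : L) : IsDerivationOfTree (theta a b) (hamDeriv a b) :=
  ⟨coe_hamDeriv_x a b, coe_hamDeriv_y a b⟩

theorem hamDeriv_lie (a b : L) : hamDeriv a b ⁅x, y⁆ = 0 := by
  rw [apply_lie_eq_zero_iff, coe_hamDeriv_x, coe_hamDeriv_y]
  exact lie_cycPartial_add_lie _

theorem hamDeriv_mem_derBideg {a b : L} {i j : ℕ} (h : (a : A) * b ∈ bideg i j) :
    hamDeriv a b ∈ derBideg i j := by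
  rw [mem_derBideg_iff, coe_hamDeriv_x, coe_hamDeriv_y]
  exact ⟨cycPartial_one_mem_bideg h, neg_mem (cycPartial_zero_mem_bideg h)⟩

/-! ### One-sided derivatives -/

theorem partialL_one (z : Fin 2) : partialL z 1 = 0 := by
  rw [← mono_nil, partialL, LinearMap.comp_apply, LinearMap.comp_apply, partialA, constr_mono]
  simp [partialWord]

theorem aug_mono_of_ne_nil {w : List (Fin 2)} (hw : w ≠ []) : aug (mono w) = 0 := by
  obtain ⟨c, w, rfl⟩ := List.exists_cons_of_ne_nil hw
  simp [mono_cons, aug]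

theorem partialL_mul_ι (z c : Fin 2) (a : A) :
    partialL z (a * FreeAlgebra.ι ℝ c) = if c = z then a else 0 := by
  induction a using mono_induction with
  | add a a' h h' => rw [add_mul, map_add, h, h']; split_ifs <;> simp
  | smul r a h => rw [smul_mul_assoc, map_smul, h]; split_ifs <;> simp
  | mono w =>
    rw [← mono_singleton, ← mono_append, partialL, LinearMap.comp_apply, LinearMap.comp_apply,
      partialA, constr_mono, partialWord, List.length_append, List.length_singleton,
      Finset.sum_range_succ, map_add, map_add, map_sum, map_sum, Finset.sum_eq_zero, zero_add]
    · simp only [List.getElem?_concat_length, Option.some.injEq]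
      split_ifs <;> simp [mono_nil]
    · intro i hi
      have hi' : i < w.length := Finset.mem_range.1 hi
      split_ifs
      · simp [aug_mono_of_ne_nil (w := (w ++ [c]).drop (i + 1)) (by simp; omega)]
      · simp

theorem eq_partialL_mul_add (a : A) :
    partialL 0 a * FreeAlgebra.ι ℝ (0 : Fin 2) + partialL 1 a * FreeAlgebra.ι ℝ (1 : Fin 2) +
      aug a • (1 : A) = a := by
  induction a using mono_induction with
  | add a b ha hb =>
    nth_rewrite 4 [← ha]
    nth_rewrite 4 [← hb]
    simp only [map_add, add_mul, add_smul]
    abel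
  | smul c a ha =>
    nth_rewrite 4 [← ha]
    simp only [map_smul, smul_mul_assoc, smul_add, smul_eq_mul, mul_smul]
  | mono w =>
    obtain rfl | ⟨v, c, rfl⟩ := w.eq_nil_or_concat'
    · simp [mono_nil, partialL_one]
    · rw [aug_mono_of_ne_nil (by simp), mono_append, mono_singleton, partialL_mul_ι,
        partialL_mul_ι]
      obtain rfl | rfl : c = 0 ∨ c = 1 := by omega
      all_goals simp

theorem partialL_zero_mem_bideg {p q : ℤ} {a : A} (ha : a ∈ bideg p q) :
    partialL 0 a ∈ bideg (p - 1) q := by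
  refine map_mem_of_mem_bideg _ _ (fun w hp hq => ?_) ha
  obtain rfl | ⟨v, c, rfl⟩ := w.eq_nil_or_concat'
  · rw [mono_nil, partialL_one]; exact zero_mem _
  · rw [mono_append, mono_singleton, partialL_mul_ι]
    split_ifs with h
    · subst h
      exact mono_mem_bideg (by simp at hp; omega) (by simpa using hq)
    · exact zero_mem _

theorem partialL_one_mem_bideg {p q : ℤ} {a : A} (ha : a ∈ bideg p q) :
    partialL 1 a ∈ bideg p (q - 1) := by
  refine map_mem_of_mem_bideg _ _ (fun w hp hq => ?_) ha
  obtain rfl | ⟨v, c, rfl⟩ := w.eq_nil_or_concat'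
  · rw [mono_nil, partialL_one]; exact zero_mem _
  · rw [mono_append, mono_singleton, partialL_mul_ι]
    split_ifs with h
    · subst h
      exact mono_mem_bideg (by simpa using hp) (by simp at hq; omega)
    · exact zero_mem _

/-! ### Polynomial representation of the elements of fixed `x`-degree -/

section Ev

variable {R : Type} [CommRing R]

/-- The value of the word `y^{p₀} x y^{p₁} x ⋯ x y^{pₙ}` under `n`, `Y` is the product of the
`Y i ^ pᵢ`; the words of `x`-degree different from `n` have value zero. -/
def evWord : ℕ → (ℕ → R) → List (Fin 2) → R
  | 0, _, [] => 1
  | _ + 1, _, [] => 0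
  | n, Y, 1 :: w => Y 0 * evWord n Y w
  | 0, _, 0 :: _ => 0
  | n + 1, Y, 0 :: w => evWord n (fun i => Y (i + 1)) w

theorem evWord_nil (n : ℕ) (Y : ℕ → R) : evWord n Y [] = if n = 0 then 1 else 0 := by
  cases n <;> simp [evWord]

theorem evWord_one_cons (n : ℕ) (Y : ℕ → R) (w : List (Fin 2)) :
    evWord n Y (1 :: w) = Y 0 * evWord n Y w := by
  cases n <;> simp [evWord]

theorem evWord_zero_zero_cons (Y : ℕ → R) (w : List (Fin 2)) : evWord 0 Y (0 :: w) = 0 := by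
  simp [evWord]

theorem evWord_succ_zero_cons (n : ℕ) (Y : ℕ → R) (w : List (Fin 2)) :
    evWord (n + 1) Y (0 :: w) = evWord n (fun i => Y (i + 1)) w := by
  simp [evWord]

/-- The last block of y's of `v` and the first block of `w` merge, so both factors use the variable
with index `p.1`; hence the shift is by `p.1` and not by `p.1 + 1`. -/
theorem evWord_append (n : ℕ) (Y : ℕ → R) (v w : List (Fin 2)) :
    evWord n Y (v ++ w) = ∑ p ∈ Finset.HasAntidiagonal.antidiagonal n,
      evWord p.1 Y v * evWord p.2 (fun i => Y (i + p.1)) w := by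
  induction v generalizing n Y with
  | nil =>
    rw [Finset.sum_eq_single (0, n)]
    · simp [evWord_nil]
    · rintro ⟨k, l⟩ h h'
      rw [Finset.HasAntidiagonal.mem_antidiagonal] at h
      have : k ≠ 0 := by rintro rfl; exact h' (by simpa using h)
      simp [evWord_nil, this]
    · simp
  | cons c v ih =>
    obtain rfl | rfl : c = 0 ∨ c = 1 := by omega
    · cases n with
      | zero => simp [evWord_zero_zero_cons]
      | succ n =>
        simp only [List.cons_append, evWord_succ_zero_cons, ih, Finset.Nat.sum_antidiagonal_succ,
          evWord_zero_zero_cons, zero_mul, zero_add, add_assoc]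
    · simp only [List.cons_append, evWord_one_cons, ih, Finset.mul_sum, mul_assoc]

theorem evWord_smul (n : ℕ) (t : R) (Y : ℕ → R) (w : List (Fin 2)) :
    evWord n (fun i => t * Y i) w = t ^ w.count 1 * evWord n Y w := by
  induction w generalizing n Y with
  | nil => rw [evWord_nil, evWord_nil]; simp
  | cons c w ih =>
    obtain rfl | rfl : c = 0 ∨ c = 1 := by omega
    · cases n with
      | zero => rw [evWord_zero_zero_cons, evWord_zero_zero_cons, mul_zero]
      | succ n => rw [evWord_succ_zero_cons, evWord_succ_zero_cons, ih]; simp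
    · rw [evWord_one_cons, evWord_one_cons, ih, List.count_cons_self, pow_succ]; ring

variable [Algebra ℝ R]

/-- The linear extension of `evWord`. -/
def ev (n : ℕ) (Y : ℕ → R) : A →ₗ[ℝ] R := monoBasis.constr ℝ fun w => evWord n Y w.toList

theorem ev_mono (n : ℕ) (Y : ℕ → R) (w : List (Fin 2)) : ev n Y (mono w) = evWord n Y w :=
  constr_mono _ w

theorem ev_mul (n : ℕ) (Y : ℕ → R) (a b : A) :
    ev n Y (a * b) = ∑ p ∈ Finset.HasAntidiagonal.antidiagonal n,
      ev p.1 Y a * ev p.2 (fun i => Y (i + p.1)) b := by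
  induction a using mono_induction with
  | add a a' h h' => simp only [add_mul, map_add, h, h', Finset.sum_add_distrib]
  | smul c a h => simp only [smul_mul_assoc, map_smul, h, Finset.smul_sum]
  | mono v =>
    induction b using mono_induction with
    | add a a' h h' => simp only [mul_add, map_add, h, h', Finset.sum_add_distrib]
    | smul c a h => simp only [mul_smul_comm, map_smul, h, Finset.smul_sum]
    | mono w => simp only [← mono_append, ev_mono, evWord_append]

theorem ev_one (n : ℕ) (Y : ℕ → R) : ev n Y 1 = if n = 0 then 1 else 0 := by
  rw [← mono_nil, ev_mono, evWord_nil]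

theorem ev_zero_ι_zero (Y : ℕ → R) : ev 0 Y (FreeAlgebra.ι ℝ 0) = 0 := by
  rw [← mono_singleton, ev_mono, evWord_zero_zero_cons]

theorem ev_succ_ι_zero (n : ℕ) (Y : ℕ → R) :
    ev (n + 1) Y (FreeAlgebra.ι ℝ 0) = if n = 0 then 1 else 0 := by
  rw [← mono_singleton, ev_mono, evWord_succ_zero_cons, evWord_nil]

theorem ev_ι_one (n : ℕ) (Y : ℕ → R) :
    ev n Y (FreeAlgebra.ι ℝ 1) = if n = 0 then Y 0 else 0 := by
  rw [← mono_singleton, ev_mono, evWord_one_cons, evWord_nil]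
  split_ifs <;> simp

theorem ev_mul_ι_one (n : ℕ) (Y : ℕ → R) (a : A) :
    ev n Y (a * FreeAlgebra.ι ℝ 1) = ev n Y a * Y n := by
  rw [ev_mul, Finset.sum_eq_single (n, 0)]
  · simp [ev_ι_one]
  · rintro ⟨k, l⟩ h h'
    rw [Finset.HasAntidiagonal.mem_antidiagonal] at h
    have : l ≠ 0 := by rintro rfl; exact h' (by simpa using h)
    simp [ev_ι_one, this]
  · simp

theorem ev_ι_one_mul (n : ℕ) (Y : ℕ → R) (a : A) :
    ev n Y (FreeAlgebra.ι ℝ 1 * a) = Y 0 * ev n Y a := by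
  rw [ev_mul, Finset.sum_eq_single (0, n)]
  · simp [ev_ι_one]
  · rintro ⟨k, l⟩ h h'
    rw [Finset.HasAntidiagonal.mem_antidiagonal] at h
    have : k ≠ 0 := by rintro rfl; exact h' (by simpa using h)
    simp [ev_ι_one, this]
  · simp

theorem ev_succ_mul_ι_zero (n : ℕ) (Y : ℕ → R) (a : A) :
    ev (n + 1) Y (a * FreeAlgebra.ι ℝ 0) = ev n Y a := by
  rw [ev_mul, Finset.Nat.sum_antidiagonal_succ', ev_zero_ι_zero, mul_zero, zero_add,
    Finset.sum_eq_single (n, 0)]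
  · simp [ev_succ_ι_zero]
  · rintro ⟨k, l⟩ h h'
    rw [Finset.HasAntidiagonal.mem_antidiagonal] at h
    have : l ≠ 0 := by rintro rfl; exact h' (by simpa using h)
    simp [ev_succ_ι_zero, this]
  · simp

theorem ev_succ_ι_zero_mul (n : ℕ) (Y : ℕ → R) (a : A) :
    ev (n + 1) Y (FreeAlgebra.ι ℝ 0 * a) = ev n (fun i => Y (i + 1)) a := by
  rw [ev_mul, Finset.Nat.sum_antidiagonal_succ, ev_zero_ι_zero, zero_mul, zero_add,
    Finset.sum_eq_single (0, n)]
  · simp [ev_succ_ι_zero]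
  · rintro ⟨k, l⟩ h h'
    rw [Finset.HasAntidiagonal.mem_antidiagonal] at h
    have : k ≠ 0 := by rintro rfl; exact h' (by simpa using h)
    simp [ev_succ_ι_zero, this]
  · simp

theorem ev_lie_ι_one (n : ℕ) (Y : ℕ → R) (a : A) :
    ev n Y ⁅a, FreeAlgebra.ι ℝ (1 : Fin 2)⁆ = ev n Y a * (Y n - Y 0) := by
  rw [LieRing.of_associative_ring_bracket, map_sub, ev_mul_ι_one, ev_ι_one_mul]
  ring

theorem ev_succ_lie_ι_zero (n : ℕ) (Y : ℕ → R) (a : A) :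
    ev (n + 1) Y ⁅FreeAlgebra.ι ℝ (0 : Fin 2), a⁆ = ev n (fun i => Y (i + 1)) a - ev n Y a := by
  rw [LieRing.of_associative_ring_bracket, map_sub, ev_succ_mul_ι_zero, ev_succ_ι_zero_mul]

/-- `ev n Y` depends only on `Y 0, …, Y n`. -/
theorem ev_congr {n : ℕ} {Y Y' : ℕ → R} (h : ∀ i ≤ n, Y i = Y' i) (a : A) :
    ev n Y a = ev n Y' a := by
  suffices ev n Y = ev n Y' by rw [this]
  refine hom_ext_mono fun w => ?_
  rw [ev_mono, ev_mono]
  induction w generalizing n Y Y' with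
  | nil => rw [evWord_nil, evWord_nil]
  | cons c w ih =>
    obtain rfl | rfl : c = 0 ∨ c = 1 := by omega
    · cases n with
      | zero => rw [evWord_zero_zero_cons, evWord_zero_zero_cons]
      | succ n =>
        rw [evWord_succ_zero_cons, evWord_succ_zero_cons]
        exact ih fun i hi => h _ (by omega)
    · rw [evWord_one_cons, evWord_one_cons, ih h, h 0 (by omega)]

theorem map_ev {S : Type} [CommRing S] [Algebra ℝ S] (φ : R →ₐ[ℝ] S) (n : ℕ) (Y : ℕ → R) (a : A) :
    φ (ev n Y a) = ev n (fun i => φ (Y i)) a := by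
  suffices φ.toLinearMap ∘ₗ ev n Y = ev n fun i => φ (Y i) from LinearMap.congr_fun this a
  refine hom_ext_mono fun w => ?_
  rw [LinearMap.comp_apply, ev_mono, ev_mono, AlgHom.toLinearMap_apply]
  induction w generalizing n Y with
  | nil => rw [evWord_nil, evWord_nil]; split_ifs <;> simp
  | cons c w ih =>
    obtain rfl | rfl : c = 0 ∨ c = 1 := by omega
    · cases n with
      | zero => rw [evWord_zero_zero_cons, evWord_zero_zero_cons, map_zero]
      | succ n => rw [evWord_succ_zero_cons, evWord_succ_zero_cons, ih]
    · rw [evWord_one_cons, evWord_one_cons, map_mul, ih]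

theorem ev_smul_of_mem_bideg {p : ℤ} {q : ℕ} {a : A} (ha : a ∈ bideg p q) (n : ℕ) (t : R)
    (Y : ℕ → R) : ev n (fun i => t * Y i) a = t ^ q * ev n Y a := by
  refine eq_of_mem_bideg (ev n fun i => t * Y i) (LinearMap.mulLeft ℝ (t ^ q) ∘ₗ ev n Y)
    (fun w _ hq => ?_) ha
  rw [LinearMap.comp_apply, ev_mono, ev_mono, evWord_smul, LinearMap.mulLeft_apply,
    Nat.cast_injective hq]

end Ev

/-! ### Faithfulness -/

/-- The exponents of the powers of `y` in a word `y^{p₀} x y^{p₁} x ⋯ x y^{pₙ}`. -/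
def exponents : List (Fin 2) → ℕ →₀ ℕ
  | [] => 0
  | c :: w => if c = 0 then (exponents w).mapDomain Nat.succ else Finsupp.single 0 1 + exponents w

theorem evWord_X (w : List (Fin 2)) :
    evWord (w.count 0) (MvPolynomial.X : ℕ → MvPolynomial ℕ ℝ) w =
      MvPolynomial.monomial (exponents w) 1 := by
  -- Reading a letter x shifts all variables, so the induction needs an arbitrary offset.
  suffices ∀ k : ℕ, evWord (w.count 0) (fun i => (MvPolynomial.X (i + k) : MvPolynomial ℕ ℝ)) w =
      MvPolynomial.monomial ((exponents w).mapDomain (· + k)) 1 by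
    have h := this 0
    have h' : (fun i : ℕ => i + 0) = id := rfl
    rwa [h', Finsupp.mapDomain_id] at h
  induction w with
  | nil => intro k; simp [evWord_nil, exponents]
  | cons c w ih =>
    intro k
    obtain rfl | rfl : c = 0 ∨ c = 1 := by omega
    · rw [List.count_cons_self, evWord_succ_zero_cons]
      simp only [exponents, if_true, ← Finsupp.mapDomain_comp]
      have := ih (k + 1)
      simp only [add_comm k, ← add_assoc] at this
      exact this
    · simp only [exponents, evWord_one_cons, Fin.one_eq_zero_iff]
      rw [List.count_cons_of_ne (by decide), ih]
      simp [Finsupp.mapDomain_add, MvPolynomial.X, MvPolynomial.monomial_mul]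

theorem exponents_injective {v w : List (Fin 2)} (hc : v.count 0 = w.count 0)
    (h : exponents v = exponents w) : v = w := by
  have h0 : ∀ w : List (Fin 2), (exponents (0 :: w)) 0 = 0 := fun w => by
    simp only [exponents, if_true]
    exact Finsupp.mapDomain_of_notMem_range _ _ (by simp)
  have h1 : ∀ w : List (Fin 2), (exponents (1 :: w)) 0 ≠ 0 := fun w => by
    simp [exponents]
  induction v generalizing w with
  | nil =>
    cases w with
    | nil => rfl
    | cons c w =>
      obtain rfl | rfl : c = 0 ∨ c = 1 := by omega
      · simp at hc
      · exact absurd (DFunLike.congr_fun h 0).symm (h1 w)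
  | cons c v ih =>
    cases w with
    | nil =>
      obtain rfl | rfl : c = 0 ∨ c = 1 := by omega
      · simp at hc
      · exact absurd (DFunLike.congr_fun h 0) (h1 v)
    | cons d w =>
      obtain rfl | rfl : c = 0 ∨ c = 1 := by omega
      all_goals obtain rfl | rfl : d = 0 ∨ d = 1 := by omega
      · rw [ih (by simpa using hc)]
        simp only [exponents, if_true] at h
        exact Finsupp.mapDomain_injective Nat.succ_injective h
      · exact absurd ((DFunLike.congr_fun h 0).symm.trans (h0 v)) (h1 w)
      · exact absurd ((DFunLike.congr_fun h 0).trans (h0 w)) (h1 v)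
      · rw [ih (by simpa using hc)]
        simpa [exponents] using h

/-- Distinct words with n letters x give distinct monomials, so the coefficients of `a` can be read
off from its polynomial. -/
theorem eq_zero_of_ev_X_eq_zero {n : ℕ} {q : ℤ} {a : A} (ha : a ∈ bideg n q)
    (h : ev n (MvPolynomial.X : ℕ → MvPolynomial ℕ ℝ) a = 0) : a = 0 := by
  classical
  refine monoBasis.ext_elem fun w => ?_
  rw [map_zero, Finsupp.zero_apply, ← Module.Basis.coord_apply]
  have key : ∀ v : List (Fin 2), monoBasis.coord w (mono v) =
      if FreeMonoid.ofList v = w then 1 else 0 := fun v => by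
    rw [← monoBasis_ofList, Module.Basis.coord_apply, Module.Basis.repr_self,
      Finsupp.single_apply]
  by_cases hw : w.toList.count 0 = n
  · have := eq_of_mem_bideg (MvPolynomial.lcoeff ℝ (exponents w.toList) ∘ₗ ev n MvPolynomial.X)
      (monoBasis.coord w) (fun v hv _ => ?_) ha
    · rw [← this, LinearMap.comp_apply, h, map_zero]
    · have hv' : v.count 0 = n := by exact_mod_cast hv
      have hvw : exponents v = exponents w.toList ↔ FreeMonoid.ofList v = w :=
        ⟨fun h => exponents_injective (hv'.trans hw.symm) h, fun h => by rw [← h]; rfl⟩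
      rw [LinearMap.comp_apply, ev_mono, ← hv', evWord_X, MvPolynomial.lcoeff_apply,
        MvPolynomial.coeff_monomial, key]
      simp only [hvw]
  · refine eq_of_mem_bideg (monoBasis.coord w) 0 (fun v hv _ => ?_) ha
    rw [key, if_neg, LinearMap.zero_apply]
    rintro rfl
    exact hw (by exact_mod_cast hv)

theorem eq_zero_of_lie_ι_one_eq_zero {n : ℕ} (hn : n ≠ 0) {q : ℤ} {a : A} (ha : a ∈ bideg n q)
    (h : ⁅a, FreeAlgebra.ι ℝ (1 : Fin 2)⁆ = 0) : a = 0 := by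
  refine eq_zero_of_ev_X_eq_zero ha ?_
  have h' := congr_arg (ev n (MvPolynomial.X : ℕ → MvPolynomial ℕ ℝ)) h
  rw [ev_lie_ι_one, map_zero, mul_eq_zero, sub_eq_zero, MvPolynomial.X_inj] at h'
  exact h'.resolve_right hn

/-! ### The representation on Lie elements of low `x`-degree -/

section LieElements

variable {R : Type} [CommRing R] [Algebra ℝ R]

theorem ev_one_mul (Y : ℕ → R) (a b : A) :
    ev 1 Y (a * b) = ev 0 Y a * ev 1 Y b + ev 1 Y a * ev 0 (fun i => Y (i + 1)) b := by
  rw [ev_mul, Finset.Nat.sum_antidiagonal_succ, Finset.Nat.antidiagonal_zero,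
    Finset.sum_singleton]
  rfl

theorem ev_two_mul (Y : ℕ → R) (a b : A) :
    ev 2 Y (a * b) = ev 0 Y a * ev 2 Y b + ev 1 Y a * ev 1 (fun i => Y (i + 1)) b +
      ev 2 Y a * ev 0 (fun i => Y (i + 2)) b := by
  rw [ev_mul, Finset.Nat.sum_antidiagonal_succ, Finset.Nat.sum_antidiagonal_succ,
    Finset.Nat.antidiagonal_zero, Finset.sum_singleton, ← add_assoc]
  rfl

/-- The part of x-degree zero of a Lie element is a multiple of y. The constant does not depend on
`Y`, which the inductions in x-degrees one and two require. -/
theorem ev_zero_of_mem_freeLie {a : A} (ha : a ∈ freeLie) :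
    ∃ c : R, ∀ Y : ℕ → R, ev 0 Y a = c * Y 0 := by
  induction ha using freeLie_induction with
  | gen c =>
    obtain rfl | rfl : c = 0 ∨ c = 1 := by omega
    · exact ⟨0, fun Y => by rw [ev_zero_ι_zero, zero_mul]⟩
    · exact ⟨1, fun Y => by rw [ev_ι_one, if_pos rfl, one_mul]⟩
  | add a b _ _ h h' =>
    obtain ⟨c, h⟩ := h
    obtain ⟨d, h'⟩ := h'
    exact ⟨c + d, fun Y => by rw [map_add, h, h', add_mul]⟩
  | smul r a _ h =>
    obtain ⟨c, h⟩ := h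
    exact ⟨r • c, fun Y => by rw [map_smul, h, smul_mul_assoc]⟩
  | lie a b _ _ h h' =>
    refine ⟨0, fun Y => ?_⟩
    simp [LieRing.of_associative_ring_bracket, ev_mul, mul_comm]

/-- In `x`-degree one, Lie elements depend only on `Y 0 - Y 1`. -/
theorem ev_one_of_mem_freeLie {a : A} (ha : a ∈ freeLie) {Y Y' : ℕ → R}
    (h : Y 0 - Y 1 = Y' 0 - Y' 1) : ev 1 Y a = ev 1 Y' a := by
  induction ha using freeLie_induction with
  | gen c =>
    obtain rfl | rfl : c = 0 ∨ c = 1 := by omega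
    · rw [ev_succ_ι_zero, ev_succ_ι_zero]
    · rw [ev_ι_one, ev_ι_one, if_neg one_ne_zero, if_neg one_ne_zero]
  | add a b _ _ ha hb => rw [map_add, map_add, ha, hb]
  | smul r a _ ha => rw [map_smul, map_smul, ha]
  | lie a b hfa hfb ha hb =>
    obtain ⟨c, hc⟩ := ev_zero_of_mem_freeLie (R := R) hfa
    obtain ⟨d, hd⟩ := ev_zero_of_mem_freeLie (R := R) hfb
    simp only [LieRing.of_associative_ring_bracket, map_sub, ev_one_mul, hc, hd, ha, hb, zero_add]
    linear_combination (c * ev 1 Y' b - d * ev 1 Y' a) * h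

/-- In `x`-degree two, Lie elements are antisymmetric in `Y 0 - Y 1` and `Y 1 - Y 2`. -/
theorem ev_two_of_mem_freeLie {a : A} (ha : a ∈ freeLie) {Y Y' : ℕ → R}
    (h : Y 0 - Y 1 = Y' 1 - Y' 2) (h' : Y 1 - Y 2 = Y' 0 - Y' 1) : ev 2 Y a = -ev 2 Y' a := by
  induction ha using freeLie_induction with
  | gen c =>
    obtain rfl | rfl : c = 0 ∨ c = 1 := by omega
    · simp [ev_succ_ι_zero]
    · simp [ev_ι_one]
  | add a b _ _ ha hb => rw [map_add, map_add, ha, hb, neg_add]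
  | smul r a _ ha => rw [map_smul, map_smul, ha, smul_neg]
  | lie a b hfa hfb ha hb =>
    obtain ⟨c, hc⟩ := ev_zero_of_mem_freeLie (R := R) hfa
    obtain ⟨d, hd⟩ := ev_zero_of_mem_freeLie (R := R) hfb
    have ha1 := ev_one_of_mem_freeLie hfa (Y := Y) (Y' := fun i => Y' (i + 1)) h
    have ha2 := ev_one_of_mem_freeLie hfa (Y := fun i => Y (i + 1)) (Y' := Y') h'
    have hb1 := ev_one_of_mem_freeLie hfb (Y := Y) (Y' := fun i => Y' (i + 1)) h
    have hb2 := ev_one_of_mem_freeLie hfb (Y := fun i => Y (i + 1)) (Y' := Y') h'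
    simp only [LieRing.of_associative_ring_bracket, map_sub, ev_two_mul, hc, hd, ha, hb, zero_add,
      ha1, ha2, hb1, hb2]
    linear_combination (-c * ev 2 Y' b + d * ev 2 Y' a) * (h + h')

/-- In `x`-degree two, Lie elements depend only on `Y 0 - Y 1` and `Y 1 - Y 2`. -/
theorem ev_two_congr_of_mem_freeLie {a : A} (ha : a ∈ freeLie) {Y Y' : ℕ → R}
    (h : Y 0 - Y 1 = Y' 0 - Y' 1) (h' : Y 1 - Y 2 = Y' 1 - Y' 2) : ev 2 Y a = ev 2 Y' a := by
  -- `Z` has the two differences of `Y` interchanged; antisymmetry is then applied twice.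
  let Z : ℕ → R := fun i => if i = 0 then Y 0 - Y 2 else if i = 1 then Y 0 - Y 1 else 0
  rw [ev_two_of_mem_freeLie ha (Y := Y) (Y' := Z), ev_two_of_mem_freeLie ha (Y := Z) (Y' := Y'),
    neg_neg]
  · simpa [Z] using h'
  · simpa [Z] using h
  · simp [Z]
  · simp [Z]

end LieElements

/-! ### Cyclic words -/

theorem mono_eq_ι_one_pow {w : List (Fin 2)} (hw : w.count 0 = 0) :
    mono w = FreeAlgebra.ι ℝ 1 ^ w.count 1 := by
  induction w with
  | nil => rw [mono_nil, List.count_nil, pow_zero]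
  | cons c w ih =>
    obtain rfl | rfl : c = 0 ∨ c = 1 := by omega
    · simp at hw
    · rw [mono_cons, ih (by simpa using hw), List.count_cons_self, pow_succ']

theorem evWord_eq_pow {R : Type} [CommRing R] (Y : ℕ → R) {w : List (Fin 2)} (hw : w.count 0 = 0) :
    evWord 0 Y w = Y 0 ^ w.count 1 := by
  induction w with
  | nil => rw [evWord_nil, List.count_nil, pow_zero, if_pos rfl]
  | cons c w ih =>
    obtain rfl | rfl : c = 0 ∨ c = 1 := by omega
    · simp at hw
    · rw [evWord_one_cons, ih (by simpa using hw), List.count_cons_self, pow_succ']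

theorem tr_mono_mul_pow {w : List (Fin 2)} (hw : w.count 0 = 1) (k : ℕ) :
    tr (mono w * FreeAlgebra.ι ℝ 1 ^ k) =
      tr (FreeAlgebra.ι ℝ 0 * FreeAlgebra.ι ℝ 1 ^ (w.count 1 + k)) := by
  induction w generalizing k with
  | nil => simp at hw
  | cons c w ih =>
    obtain rfl | rfl : c = 0 ∨ c = 1 := by omega
    · rw [mono_cons, mono_eq_ι_one_pow (by simpa using hw), mul_assoc, ← pow_add,
        List.count_cons_of_ne (by decide)]
    · rw [mono_cons, mul_assoc, tr_mul_comm, mul_assoc, ← pow_succ, ih (by simpa using hw),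
        List.count_cons_self, add_assoc, add_comm 1]

theorem evWord_one_const {w : List (Fin 2)} (hw : w.count 0 = 1) :
    evWord 1 (fun _ => (1 : ℝ)) w = 1 := by
  induction w with
  | nil => simp at hw
  | cons c w ih =>
    obtain rfl | rfl : c = 0 ∨ c = 1 := by omega
    · rw [evWord_succ_zero_cons, evWord_eq_pow _ (by simpa using hw), one_pow]
    · rw [evWord_one_cons, ih (by simpa using hw), one_mul]

/-- The only cyclic word with one x and q letters y is tr(x y^q), so the trace sees only the sum of
the coefficients. -/
theorem tr_eq_zero_of_mem_bideg_one {q : ℤ} {a : A} (ha : a ∈ bideg 1 q)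
    (h : ev 1 (fun _ => (1 : ℝ)) a = 0) : tr a = 0 := by
  have := eq_of_mem_bideg tr ((ev 1 fun _ => (1 : ℝ)).smulRight
    (tr (FreeAlgebra.ι ℝ 0 * FreeAlgebra.ι ℝ 1 ^ q.toNat))) (fun w hp hq => ?_) ha
  · rw [this, LinearMap.smulRight_apply, h, zero_smul]
  · have hp' : w.count 0 = 1 := by exact_mod_cast hp
    have h1 := tr_mono_mul_pow hp' 0
    rw [pow_zero, mul_one, add_zero] at h1
    rw [LinearMap.smulRight_apply, ev_mono, evWord_one_const hp', one_smul, h1, ← hq,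
      Int.toNat_natCast]

/-- The sequence `u, v, u, v, …`. -/
def alternate {R : Type} (u v : R) : ℕ → R
  | 0 => u
  | n + 1 => alternate v u n

/-- The linear map sending `u ^ k * v ^ l` to `tr (x y ^ l x y ^ k)`. -/
def necklace : MvPolynomial (Fin 2) ℝ →ₗ[ℝ] Tr :=
  (MvPolynomial.basisMonomials (Fin 2) ℝ).constr ℝ fun m =>
    tr (FreeAlgebra.ι ℝ 0 * FreeAlgebra.ι ℝ 1 ^ m 1 * FreeAlgebra.ι ℝ 0 * FreeAlgebra.ι ℝ 1 ^ m 0)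

theorem necklace_pow_mul_pow (k l : ℕ) :
    necklace (MvPolynomial.X 0 ^ k * MvPolynomial.X 1 ^ l) =
      tr (FreeAlgebra.ι ℝ 0 * FreeAlgebra.ι ℝ 1 ^ l * FreeAlgebra.ι ℝ 0 *
        FreeAlgebra.ι ℝ 1 ^ k) := by
  have h : (MvPolynomial.X 0 ^ k * MvPolynomial.X 1 ^ l : MvPolynomial (Fin 2) ℝ) =
      MvPolynomial.basisMonomials (Fin 2) ℝ (Finsupp.single 0 k + Finsupp.single 1 l) := by
    rw [MvPolynomial.coe_basisMonomials, MvPolynomial.X_pow_eq_monomial,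
      MvPolynomial.X_pow_eq_monomial, MvPolynomial.monomial_mul, mul_one]
  rw [h, necklace, Module.Basis.constr_basis]
  simp

theorem necklace_evWord_one {w : List (Fin 2)} (hw : w.count 0 = 1) (k l : ℕ) :
    necklace (MvPolynomial.X 0 ^ k * MvPolynomial.X 1 ^ l *
      evWord 1 (alternate (MvPolynomial.X 1) (MvPolynomial.X 0)) w) =
      tr (FreeAlgebra.ι ℝ 0 * FreeAlgebra.ι ℝ 1 ^ l * mono w * FreeAlgebra.ι ℝ 1 ^ k) := by
  induction w generalizing l with
  | nil => simp at hw
  | cons c w ih =>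
    obtain rfl | rfl : c = 0 ∨ c = 1 := by omega
    · have hw' : w.count 0 = 0 := by simpa using hw
      rw [evWord_succ_zero_cons, evWord_eq_pow _ hw', mono_cons, mono_eq_ι_one_pow hw']
      change necklace (_ * MvPolynomial.X 0 ^ _) = _
      rw [mul_right_comm, ← pow_add, necklace_pow_mul_pow, add_comm, pow_add]
      simp only [mul_assoc]
    · have h := ih (by simpa using hw) (l + 1)
      rw [evWord_one_cons, mono_cons]
      simp only [pow_succ, mul_assoc] at h ⊢
      exact h

theorem necklace_evWord_two {w : List (Fin 2)} (hw : w.count 0 = 2) (k : ℕ) :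
    necklace (MvPolynomial.X 0 ^ k *
      evWord 2 (alternate (MvPolynomial.X 0) (MvPolynomial.X 1)) w) =
      tr (mono w * FreeAlgebra.ι ℝ 1 ^ k) := by
  induction w generalizing k with
  | nil => simp at hw
  | cons c w ih =>
    obtain rfl | rfl : c = 0 ∨ c = 1 := by omega
    · have h := necklace_evWord_one (w := w) (by simpa using hw) k 0
      rw [pow_zero, pow_zero, mul_one, mul_one] at h
      rw [evWord_succ_zero_cons, mono_cons]
      exact h
    · rw [evWord_one_cons, mono_cons, mul_assoc, tr_mul_comm, mul_assoc, ← pow_succ,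
        ← ih (by simpa using hw), pow_succ, mul_assoc]
      rfl

/-- The first and last blocks of y's are adjacent on the circle, so their variables are identified:
Y₀ = Y₂ = u, Y₁ = v. -/
theorem tr_eq_necklace_of_mem_bideg_two {q : ℤ} {a : A} (ha : a ∈ bideg 2 q) :
    tr a = necklace (ev 2 (alternate (MvPolynomial.X 0) (MvPolynomial.X 1)) a) := by
  refine eq_of_mem_bideg tr (necklace ∘ₗ ev 2 _) (fun w hp _ => ?_) ha
  have h := necklace_evWord_two (w := w) (by exact_mod_cast hp) 0
  rw [pow_zero, pow_zero, mul_one, one_mul] at h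
  rw [LinearMap.comp_apply, ev_mono, h]

/-- A rotation may interchange the two blocks, that is, u and v; symmetrising makes the evaluation
vanish on commutators. -/
theorem ev_two_alternate_eq_zero {R : Type} [CommRing R] [Algebra ℝ R] (u v : R) {a : A}
    (ha : tr a = 0) : ev 2 (alternate u v) a + ev 2 (alternate v u) a = 0 := by
  have h : commSpan ≤ LinearMap.ker (ev 2 (alternate u v) + ev 2 (alternate v u)) := by
    refine Submodule.span_le.2 ?_
    rintro _ ⟨a, b, rfl⟩
    have h1 (u v : R) : (fun i => alternate u v (i + 1)) = alternate v u := rfl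
    have h2 (u v : R) : (fun i => alternate u v (i + 2)) = alternate u v := rfl
    simp only [SetLike.mem_coe, LinearMap.mem_ker, LinearMap.add_apply, map_sub, ev_two_mul, h1, h2]
    ring
  exact h ((Submodule.Quotient.mk_eq_zero _).1 ha)

/-! ### The representation on one-sided derivatives -/

section PartialL

variable {R : Type} [CommRing R] [Algebra ℝ R]

/-- ∂^L_x keeps the words ending in x; these have no trailing y and are selected by setting the last
variable to zero. -/
theorem ev_partialL_zero (n : ℕ) {Y : ℕ → R} (hY : Y (n + 1) = 0) (a : A) :
    ev n Y (partialL 0 a) = ev (n + 1) Y a := by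
  conv_rhs => rw [← eq_partialL_mul_add a]
  rw [map_add, map_add, ev_succ_mul_ι_zero, ev_mul_ι_one, hY, map_smul, ev_one,
    if_neg n.succ_ne_zero, smul_zero, mul_zero, add_zero, add_zero]

theorem ev_partialL_one_mul (n : ℕ) (Y : ℕ → R) (a : A) :
    ev (n + 1) Y (partialL 1 a) * Y (n + 1) =
      ev (n + 1) Y a - ev (n + 1) (Function.update Y (n + 1) 0) a := by
  rw [← ev_partialL_zero n (Y := Function.update Y (n + 1) 0) (Function.update_self _ _ _),
    ev_congr (Y := Function.update Y (n + 1) 0) (Y' := Y)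
      fun i hi => Function.update_of_ne (by omega) _ _]
  conv_rhs => enter [1]; rw [← eq_partialL_mul_add a]
  rw [map_add, map_add, ev_succ_mul_ι_zero, ev_mul_ι_one, map_smul, ev_one,
    if_neg n.succ_ne_zero]
  simp

end PartialL

/-! ### Binary forms of sign type under the symmetric group `S₃` -/

section SignForms

open MvPolynomial

/-- The substitution `(s, t) ↦ (t, s)`. -/
def swapHom : MvPolynomial (Fin 2) ℝ →ₐ[ℝ] MvPolynomial (Fin 2) ℝ := aeval ![X 1, X 0]

/-- The substitution `(s, t) ↦ (t, -s - t)`. -/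
def rotHom : MvPolynomial (Fin 2) ℝ →ₐ[ℝ] MvPolynomial (Fin 2) ℝ := aeval ![X 1, -X 0 - X 1]

theorem swapHom_X_zero : swapHom (X 0) = X 1 := by simp [swapHom]
theorem swapHom_X_one : swapHom (X 1) = X 0 := by simp [swapHom]
theorem rotHom_X_zero : rotHom (X 0) = X 1 := by simp [rotHom]
theorem rotHom_X_one : rotHom (X 1) = -X 0 - X 1 := by simp [rotHom]

/-- The binary forms of degree `j` on which `S₃`, acting on `s`, `t`, `-s - t` by permutations,
acts through the sign character. -/
def signForms (j : ℕ) : Submodule ℝ (MvPolynomial (Fin 2) ℝ) where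
  carrier := {g | g.IsHomogeneous j ∧ swapHom g = -g ∧ rotHom g = g}
  zero_mem' := ⟨isHomogeneous_zero _ _ _, by simp, by simp⟩
  add_mem' := by
    rintro g h ⟨h1, h2, h3⟩ ⟨h1', h2', h3'⟩
    exact ⟨h1.add h1', by rw [map_add, h2, h2', neg_add], by rw [map_add, h3, h3']⟩
  smul_mem' := by
    rintro c g ⟨h1, h2, h3⟩
    exact ⟨(homogeneousSubmodule (Fin 2) ℝ j).smul_mem c h1, by rw [map_smul, h2, smul_neg],
      by rw [map_smul, h3]⟩

theorem mem_signForms {j : ℕ} {g : MvPolynomial (Fin 2) ℝ} :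
    g ∈ signForms j ↔ g.IsHomogeneous j ∧ swapHom g = -g ∧ rotHom g = g := Iff.rfl

instance (j : ℕ) : Module.Finite ℝ (signForms j) := by
  have : Module.Finite ℝ (homogeneousSubmodule (Fin 2) ℝ j) :=
    Module.Finite.iff_fg.2 (homogeneousSubmodule_fg _ _ j)
  exact Submodule.finiteDimensional_of_le (S₂ := homogeneousSubmodule (Fin 2) ℝ j) fun g hg => hg.1

/-! ### Divisibility of sign forms by the invariant cubic form -/

theorem eval_mul_of_isHomogeneous {j : ℕ} {g : MvPolynomial (Fin 2) ℝ} (hg : g.IsHomogeneous j)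
    (c : ℝ) (p : Fin 2 → ℝ) : eval (fun i => c * p i) g = c ^ j * eval p g := by
  rw [eval_eq', eval_eq', Finset.mul_sum]
  refine Finset.sum_congr rfl fun d hd => ?_
  rw [hg.degree_eq_sum_deg_support hd, ← Finsupp.degree_apply, Finsupp.degree_eq_sum]
  simp only [mul_pow, Finset.prod_mul_distrib, Finset.prod_pow_eq_pow_sum]
  ring

theorem X_one_dvd_of_eval_eq_zero {j : ℕ} {g : MvPolynomial (Fin 2) ℝ} (hg : g.IsHomogeneous j)
    (h : eval ![1, 0] g = 0) : X 1 ∣ g := by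
  have hd : ∀ d ∈ g.support, d 1 = 0 → d = Finsupp.single 0 j := fun d hd h1 => by
    have := hg.degree_eq_sum_deg_support hd
    rw [← Finsupp.degree_apply, Finsupp.degree_eq_sum] at this
    ext i
    fin_cases i
    · simpa [Fin.sum_univ_two, h1] using this.symm
    · simpa using h1
  have hc : coeff (Finsupp.single 0 j) g = 0 := by
    rw [← h, eval_eq', Finset.sum_eq_single (Finsupp.single 0 j)]
    · simp [Fin.prod_univ_two]
    · intro d hd' hne
      have : d 1 ≠ 0 := fun h1 => hne (hd d hd' h1)
      simp [Fin.prod_univ_two, this]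
    · intro h
      simp [notMem_support_iff.1 h]
  rw [g.as_sum]
  refine Finset.dvd_sum fun d hd' => X_dvd_monomial.2 (Or.inr fun h1 => ?_)
  rw [hd d hd' h1, mem_support_iff, hc] at hd'
  exact hd' rfl

/-- Only the component of `h` of degree `j - k` can contribute to the product; the alternative `p *
h = 0` covers `k > j`. -/
theorem exists_isHomogeneous_factor {j k : ℕ} {p h : MvPolynomial (Fin 2) ℝ}
    (hp : p.IsHomogeneous k) (hph : (p * h).IsHomogeneous j) :
    (k ≤ j ∧ ∃ h', h'.IsHomogeneous (j - k) ∧ p * h = p * h') ∨ p * h = 0 := by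
  have key : p * h = ∑ i ∈ Finset.range (h.totalDegree + 1),
      if j = k + i then p * homogeneousComponent i h else 0 := by
    conv_lhs => rw [← homogeneousComponent_eq_self hph, ← sum_homogeneousComponent h,
      Finset.mul_sum, map_sum]
    refine Finset.sum_congr rfl fun i _ => ?_
    rw [homogeneousComponent_of_mem (hp.mul (homogeneousComponent_isHomogeneous i h))]
  by_cases hk : k ≤ j
  · refine Or.inl ⟨hk, homogeneousComponent (j - k) h, homogeneousComponent_isHomogeneous _ _, ?_⟩
    by_cases hj : j - k ∈ Finset.range (h.totalDegree + 1)
    · rw [key, Finset.sum_eq_single (j - k), if_pos (by omega)]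
      · exact fun i _ hi => if_neg (by omega)
      · exact fun h => absurd hj h
    · rw [homogeneousComponent_eq_zero _ _ (by rw [Finset.mem_range] at hj; omega), mul_zero, key]
      refine Finset.sum_eq_zero fun i hi => if_neg ?_
      rintro rfl
      exact hj (by simpa using hi)
  · right
    rw [key]
    exact Finset.sum_eq_zero fun i _ => if_neg (by omega)

/-- The invariant cubic form `s t (s + t)`. -/
def cubicForm : MvPolynomial (Fin 2) ℝ := X 0 * X 1 * (X 0 + X 1)

theorem cubicForm_ne_zero : cubicForm ≠ 0 := by
  intro h
  have := congr_arg (eval ![1, 1]) h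
  norm_num [cubicForm] at this

theorem isHomogeneous_cubicForm : cubicForm.IsHomogeneous 3 :=
  ((isHomogeneous_X _ _).mul (isHomogeneous_X _ _)).mul
    ((isHomogeneous_X _ _).add (isHomogeneous_X _ _))

theorem swapHom_cubicForm : swapHom cubicForm = cubicForm := by
  simp only [cubicForm, map_mul, map_add, swapHom_X_zero, swapHom_X_one]
  ring

theorem rotHom_cubicForm : rotHom cubicForm = cubicForm := by
  simp only [cubicForm, map_mul, map_add, rotHom_X_zero, rotHom_X_one]
  ring

theorem cubicForm_mul_mem_signForms {j : ℕ} {h : MvPolynomial (Fin 2) ℝ} (hh : h ∈ signForms j) :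
    cubicForm * h ∈ signForms (j + 3) := by
  obtain ⟨h1, h2, h3⟩ := hh
  refine ⟨?_, ?_, ?_⟩
  · rw [add_comm]; exact isHomogeneous_cubicForm.mul h1
  · rw [map_mul, swapHom_cubicForm, h2, mul_neg]
  · rw [map_mul, rotHom_cubicForm, h3]

/-- Vanishing at (1, 0) gives the factor t; the swap then gives the factor s, and the rotation the
factor s + t. -/
theorem cubicForm_dvd {j : ℕ} {g : MvPolynomial (Fin 2) ℝ} (hg : g ∈ signForms j)
    (h : eval ![1, 0] g = 0) : cubicForm ∣ g := by
  obtain ⟨h1, h2, h3⟩ := hg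
  obtain ⟨a, ha⟩ := X_one_dvd_of_eval_eq_zero h1 h
  have h4 : (X 0 : MvPolynomial (Fin 2) ℝ) ∣ X 1 * a := by
    rw [← ha, ← neg_neg g, ← h2, ha, map_mul, swapHom_X_one, ← mul_neg]
    exact dvd_mul_right _ _
  obtain ⟨m, rfl⟩ := (X_dvd_mul_iff.1 h4).resolve_left (by simp [X_dvd_X])
  have h5 : X 0 * m = -(X 0 + X 1) * rotHom m := by
    rw [ha] at h3
    simp only [map_mul, rotHom_X_zero, rotHom_X_one] at h3
    refine mul_left_cancel₀ (X_ne_zero (1 : Fin 2) (R := ℝ)) ?_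
    linear_combination -h3
  have h6 : (X 0 : MvPolynomial (Fin 2) ℝ) ∣ -(X 0 + X 1) * rotHom m := ⟨m, h5.symm⟩
  obtain ⟨k, hk⟩ := (X_dvd_mul_iff.1 h6).resolve_left
    (by rw [dvd_neg, dvd_add_right dvd_rfl, X_dvd_X]; decide)
  have h7 : m = -(X 0 + X 1) * k := by
    refine mul_left_cancel₀ (X_ne_zero (0 : Fin 2) (R := ℝ)) ?_
    rw [h5, hk]
    ring
  exact ⟨-k, by rw [ha, h7, cubicForm]; ring⟩

theorem exists_eq_cubicForm_mul {j : ℕ} {g : MvPolynomial (Fin 2) ℝ} (hg : g ∈ signForms j)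
    (h : eval ![1, 0] g = 0) :
    (3 ≤ j ∧ ∃ h ∈ signForms (j - 3), g = cubicForm * h) ∨ g = 0 := by
  obtain ⟨h, rfl⟩ := cubicForm_dvd hg h
  refine (exists_isHomogeneous_factor isHomogeneous_cubicForm hg.1).imp_left ?_
  rintro ⟨hj, h', h1, h2⟩
  refine ⟨hj, h', ⟨h1, ?_, ?_⟩, h2⟩
  · have h3 := hg.2.1
    rw [h2, map_mul, swapHom_cubicForm, ← mul_neg] at h3
    exact mul_left_cancel₀ cubicForm_ne_zero h3
  · have h3 := hg.2.2
    rw [h2, map_mul, rotHom_cubicForm] at h3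
    exact mul_left_cancel₀ cubicForm_ne_zero h3

theorem eval_swapHom (p : Fin 2 → ℝ) (g : MvPolynomial (Fin 2) ℝ) :
    eval p (swapHom g) = eval ![p 1, p 0] g := by
  have : (aeval p : MvPolynomial (Fin 2) ℝ →ₐ[ℝ] ℝ).comp swapHom = aeval ![p 1, p 0] := by
    ext i; fin_cases i <;> simp [swapHom]
  simpa [coe_aeval_eq_eval] using AlgHom.congr_fun this g

theorem eval_rotHom (p : Fin 2 → ℝ) (g : MvPolynomial (Fin 2) ℝ) :
    eval p (rotHom g) = eval ![p 1, -p 0 - p 1] g := by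
  have : (aeval p : MvPolynomial (Fin 2) ℝ →ₐ[ℝ] ℝ).comp rotHom = aeval ![p 1, -p 0 - p 1] := by
    ext i; fin_cases i <;> simp [rotHom]
  simpa [coe_aeval_eq_eval] using AlgHom.congr_fun this g

/-- Rotation gives g(1, 0) = g(0, −1), the swap gives g(1, 0) = −g(0, 1), and even degree identifies
g(0, −1) with g(0, 1). -/
theorem eval_eq_zero_of_even {j : ℕ} (hj : Even j) {g : MvPolynomial (Fin 2) ℝ}
    (hg : g ∈ signForms j) : eval ![1, 0] g = 0 := by
  obtain ⟨h1, h2, h3⟩ := hg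
  have e1 : eval ![1, 0] g = eval ![0, -1] g := by
    conv_lhs => rw [← h3, eval_rotHom]
    simp
  have e2 : eval ![1, 0] g = -eval ![0, 1] g := by
    have := congr_arg (eval ![0, 1]) h2
    rw [eval_swapHom, map_neg] at this
    exact this
  have e3 := eval_mul_of_isHomogeneous h1 (-1) ![0, 1]
  rw [hj.neg_one_pow, one_mul] at e3
  have e4 : (fun i => -1 * (![0, 1] : Fin 2 → ℝ) i) = ![0, -1] := by
    ext i; fin_cases i <;> simp
  rw [e4] at e3
  linarith

/-- A base case of its own: the degree is odd, but too small for the Vandermonde form of degree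
three. -/
theorem signForms_one : signForms 1 = ⊥ := by
  refine (Submodule.eq_bot_iff _).2 fun g hg => ?_
  obtain ⟨h1, h2, h3⟩ := hg
  have h4 : g ∈ Submodule.span ℝ (Set.range X) := by
    rw [← homogeneousSubmodule_one_eq_span_X]
    exact h1
  obtain ⟨c, rfl⟩ := (Submodule.mem_span_range_iff_exists_fun ℝ).1 h4
  have e1 := congr_arg (eval ![1, 0]) h2
  have e2 := congr_arg (eval ![1, 0]) h3
  have e3 := congr_arg (eval ![0, 1]) h3
  simp [eval_swapHom, eval_rotHom, smul_eval] at e1 e2 e3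
  have c0 : c 0 = 0 := by linarith
  have c1 : c 1 = 0 := by linarith
  simp [c0, c1]

/-- A form of sign type not divisible by the cubic form. -/
theorem exists_mem_signForms_eval_ne_zero {j : ℕ} (hj : Odd j) (h3 : 3 ≤ j) :
    ∃ g ∈ signForms j, eval ![1, 0] g ≠ 0 := by
  obtain ⟨k, rfl⟩ : ∃ k, j = 1 + 1 + 1 + 2 * k := by
    obtain ⟨m, rfl⟩ := hj
    exact ⟨m - 1, by omega⟩
  have hs := isHomogeneous_X (R := ℝ) (0 : Fin 2)
  have ht := isHomogeneous_X (R := ℝ) (1 : Fin 2)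
  -- The Vandermonde product (s − t)(s − r)(t − r) with r = −s − t, times a power of the invariant
  -- quadratic form; its value at (1, 0) is 2.
  refine ⟨(X 0 - X 1) * (X 0 + (X 0 + X 1)) * (X 0 + X 1 + X 1) *
    (X 0 * X 0 + X 0 * X 1 + X 1 * X 1) ^ k, ⟨?_, ?_, ?_⟩, ?_⟩
  · exact (((hs.sub ht).mul (hs.add (hs.add ht))).mul ((hs.add ht).add ht)).mul
      ((((hs.mul hs).add (hs.mul ht)).add (ht.mul ht)).pow k)
  · simp only [map_mul, map_add, map_sub, map_pow, swapHom_X_zero, swapHom_X_one]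
    ring
  · simp only [map_mul, map_add, map_sub, map_pow, rotHom_X_zero, rotHom_X_one]
    ring
  · simp

/-- Rank–nullity for evaluation at (1, 0): the kernel is the image of the injective multiplication
by `cubicForm`, and the evaluation is onto in odd degree and zero in even degree. -/
theorem finrank_signForms_add_three (j : ℕ) :
    Module.finrank ℝ (signForms (j + 3)) =
      Module.finrank ℝ (signForms j) + if Odd (j + 3) then 1 else 0 := by
  let f : signForms j →ₗ[ℝ] signForms (j + 3) :=
    (LinearMap.mulLeft ℝ cubicForm).restrict fun h hh => cubicForm_mul_mem_signForms hh
  let ℓ : signForms (j + 3) →ₗ[ℝ] ℝ := (aeval ![1, 0]).toLinearMap ∘ₗ (signForms (j + 3)).subtype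
  have hℓ (g : signForms (j + 3)) : ℓ g = eval ![1, 0] (g : MvPolynomial (Fin 2) ℝ) := by
    simp [ℓ]
  have hf : Function.Injective f := fun a b hab => Subtype.ext <|
    mul_left_cancel₀ cubicForm_ne_zero (congr_arg Subtype.val hab)
  have hr : LinearMap.range f = LinearMap.ker ℓ := by
    ext g
    rw [LinearMap.mem_ker, LinearMap.mem_range, hℓ]
    constructor
    · rintro ⟨h, rfl⟩
      simp [f, cubicForm]
    · intro h
      obtain ⟨-, a, ha, hg⟩ | h0 := exists_eq_cubicForm_mul g.2 h
      · exact ⟨⟨a, ha⟩, Subtype.ext hg.symm⟩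
      · exact ⟨0, by rw [map_zero]; exact Subtype.ext h0.symm⟩
  have h1 := LinearMap.finrank_range_add_finrank_ker ℓ
  rw [← hr, LinearMap.finrank_range_of_inj hf] at h1
  rw [← h1, add_comm, add_right_inj]
  split_ifs with hj
  · obtain ⟨g, hg, hne⟩ := exists_mem_signForms_eval_ne_zero hj (by omega)
    rw [LinearMap.range_eq_top.2, finrank_top, Module.finrank_self]
    exact LinearMap.surjective_of_ne_zero (f := ℓ) fun h => hne (by rw [← hℓ ⟨g, hg⟩, h]; rfl)
  · rw [Nat.not_odd_iff_even] at hj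
    have : ℓ = 0 := LinearMap.ext fun g => by rw [hℓ, eval_eq_zero_of_even hj g.2]; rfl
    rw [this, LinearMap.range_zero, finrank_bot]

theorem signForms_eq_bot_of_even {j : ℕ} (hj : Even j) (h3 : j < 3) : signForms j = ⊥ := by
  refine (Submodule.eq_bot_iff _).2 fun g hg => ?_
  exact (exists_eq_cubicForm_mul hg (eval_eq_zero_of_even hj hg)).resolve_left (by omega)

theorem finrank_signForms (j : ℕ) :
    Module.finrank ℝ (signForms j) = if Odd j then (j + 3) / 6 else j / 6 := by
  induction j using Nat.strong_induction_on with
  | _ j ih =>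
    obtain h | ⟨k, rfl⟩ : j < 3 ∨ ∃ k, j = k + 3 := by
      by_cases h : j < 3
      exacts [Or.inl h, Or.inr ⟨j - 3, by omega⟩]
    · obtain rfl | hj : j = 1 ∨ Even j := by
        interval_cases j <;> simp
      · rw [signForms_one, finrank_bot]; decide
      · rw [signForms_eq_bot_of_even hj h, finrank_bot, if_neg (by simpa using hj)]
        omega
    · rw [finrank_signForms_add_three, ih k (by omega)]
      simp only [Nat.odd_iff]
      split_ifs <;> omega

theorem finrank_signForms_of_odd {j : ℕ} (hj : Odd j) :
    (Module.finrank ℝ (signForms j) : ℤ) = ⌊((j : ℚ) - 1) / 2⌋ - ⌊((j : ℚ) - 1) / 3⌋ := by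
  obtain ⟨m, rfl⟩ := hj
  have h2 : ⌊(((2 * m + 1 : ℕ) : ℚ) - 1) / 2⌋ = (2 * m : ℤ) / 2 := by
    have := Rat.floor_intCast_div_natCast (2 * m) 2
    push_cast at this ⊢
    rwa [add_sub_cancel_right]
  have h3 : ⌊(((2 * m + 1 : ℕ) : ℚ) - 1) / 3⌋ = (2 * m : ℤ) / 3 := by
    have := Rat.floor_intCast_div_natCast (2 * m) 3
    push_cast at this ⊢
    rwa [add_sub_cancel_right]
  rw [h2, h3, finrank_signForms, if_pos ⟨m, rfl⟩]
  omega

end SignForms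

/-! ### The Lie elements `ad_y^j (x)` -/

/-- The Lie element `ad_y^j (x)`. -/
def adX (j : ℕ) : L := ((LieAlgebra.ad ℝ L y) ^ j) x

theorem coe_adX_zero : (adX 0 : A) = FreeAlgebra.ι ℝ (0 : Fin 2) := rfl

theorem coe_adX_succ (j : ℕ) : (adX (j + 1) : A) = ⁅FreeAlgebra.ι ℝ (1 : Fin 2), (adX j : A)⁆ := by
  rw [adX, pow_succ']
  rfl

theorem adX_mem_bideg (j : ℕ) : (adX j : A) ∈ bideg 1 j := by
  induction j with
  | zero => exact ι_zero_mem_bideg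
  | succ j ih =>
    rw [coe_adX_succ]
    have := lie_mem_bideg ι_one_mem_bideg ih
    rwa [zero_add, add_comm 1 (j : ℤ), ← Nat.cast_succ] at this

section Ev

variable {R : Type} [CommRing R] [Algebra ℝ R]

theorem ev_lie_swap (n : ℕ) (Y : ℕ → R) (a b : A) : ev n Y ⁅a, b⁆ = -ev n Y ⁅b, a⁆ := by
  rw [← lie_skew, map_neg]

theorem ev_zero_adX (Y : ℕ → R) (j : ℕ) : ev 0 Y (adX j : A) = 0 := by
  cases j with
  | zero => rw [coe_adX_zero, ev_zero_ι_zero]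
  | succ j => rw [coe_adX_succ, ev_lie_swap, ev_lie_ι_one, sub_self, mul_zero, neg_zero]

theorem ev_one_adX (Y : ℕ → R) (j : ℕ) : ev 1 Y (adX j : A) = (Y 0 - Y 1) ^ j := by
  induction j with
  | zero => rw [coe_adX_zero, ev_succ_ι_zero, if_pos rfl, pow_zero]
  | succ j ih => rw [coe_adX_succ, ev_lie_swap, ev_lie_ι_one, ih]; ring

theorem ev_two_lie_adX (Y : ℕ → R) (k l : ℕ) : ev 2 Y ⁅(adX k : A), (adX l : A)⁆ =
    (Y 0 - Y 1) ^ k * (Y 1 - Y 2) ^ l - (Y 0 - Y 1) ^ l * (Y 1 - Y 2) ^ k := by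
  simp [LieRing.of_associative_ring_bracket, ev_two_mul, ev_zero_adX, ev_one_adX]

/-- By `sandwich_lie` each ad_y on the first argument becomes a bracket [·, y] on `b`, that is, a
factor Yₙ − Y₀. -/
theorem ev_sandwich_adX (n : ℕ) (Y : ℕ → R) (j : ℕ) (b : A) :
    ev n Y (sandwich 0 (adX j) b) = (Y n - Y 0) ^ j * ev n Y b := by
  induction j generalizing b with
  | zero => rw [coe_adX_zero, sandwich_ι, if_pos rfl, pow_zero, one_mul]
  | succ j ih =>
    rw [coe_adX_succ, sandwich_lie, sandwich_ι, if_neg (by decide), zero_add, ih, ev_lie_ι_one]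
    ring

/-- The consequence of `u([x, y]) = 0` for the polynomial representations. -/
theorem ev_apply_x_mul {u : Der} (h : u ⁅x, y⁆ = 0) (n : ℕ) (Y : ℕ → R) :
    ev (n + 1) Y (u x : A) * (Y (n + 1) - Y 0) =
      ev n Y (u y : A) - ev n (fun i => Y (i + 1)) (u y : A) := by
  have h' := congr_arg (ev (n + 1) Y) ((apply_lie_eq_zero_iff u).1 h)
  rw [map_add, ev_lie_ι_one, ev_succ_lie_ι_zero, map_zero] at h'
  linear_combination h'

end Ev

/-- If u(y) = 0 then u(x) commutes with y, which is impossible for a non-zero element of positive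
x-degree. -/
theorem eq_zero_of_apply_y_eq_zero {i j : ℕ} (hi : i ≠ 0) {u : Der} (hu : u ∈ derBideg i j)
    (h : u ⁅x, y⁆ = 0) (hy : u y = 0) : u = 0 := by
  have h' := (apply_lie_eq_zero_iff u).1 h
  rw [hy, ZeroMemClass.coe_zero, lie_zero, add_zero] at h'
  have hx : u x = 0 := Subtype.ext (eq_zero_of_lie_ι_one_eq_zero hi (mem_derBideg_iff.1 hu).1 h')
  exact der_ext (hx.trans rfl) (hy.trans rfl)

/-! ### Derivations of `x`-degree one -/

/-- The sequence `p, q, r, r, …`. -/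
def triple {R : Type} (p q r : R) : ℕ → R
  | 0 => p
  | 1 => q
  | _ + 2 => r

theorem eq_smul_adX {j : ℕ} {b : L} (hb : (b : A) ∈ bideg 1 j) :
    b = ev 1 (Pi.single 0 (1 : ℝ)) (b : A) • adX j := by
  refine Subtype.ext (sub_eq_zero.1 (eq_zero_of_ev_X_eq_zero (n := 1)
    (sub_mem hb (Submodule.smul_mem _ _ (adX_mem_bideg j))) ?_))
  have h1 : ev 1 (MvPolynomial.X : ℕ → MvPolynomial ℕ ℝ) (b : A) =
      (MvPolynomial.X 0 - MvPolynomial.X 1) ^ j *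
        algebraMap ℝ _ (ev 1 (Pi.single 0 (1 : ℝ)) (b : A)) := by
    -- The variables are compared with (X 0 − X 1)·(1, 0, 0, …), which has the same difference of
    -- its first two entries.
    rw [← Algebra.ofId_apply, map_ev, ← ev_smul_of_mem_bideg hb]
    refine ev_one_of_mem_freeLie b.2 ?_
    simp
  rw [map_sub, SetLike.val_smul, map_smul, ev_one_adX, h1, Algebra.smul_def, mul_comm, sub_self]

theorem ev_one_eq {R : Type} [CommRing R] [Algebra ℝ R] {j : ℕ} {b : L} (hb : (b : A) ∈ bideg 1 j)
    (Y : ℕ → R) :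
    ev 1 Y (b : A) = ev 1 (Pi.single 0 (1 : ℝ)) (b : A) • (Y 0 - Y 1) ^ j := by
  conv_lhs => rw [eq_smul_adX hb]
  rw [SetLike.val_smul, map_smul, ev_one_adX]

theorem divergence_eq_zero_of_mem_derBideg_two {j : ℕ} {u : Der} (hu : u ∈ derBideg 2 j)
    (h : u ⁅x, y⁆ = 0) : divergence u = 0 := by
  obtain ⟨hx, hy⟩ := mem_derBideg_iff.1 hu
  rw [Nat.cast_ofNat] at hx hy
  rw [show (2 : ℤ) - 1 = 1 by norm_num] at hy
  have hmem : partialL 0 (u x : A) + partialL 1 (u y : A) ∈ bideg 1 ((j : ℤ) - 1) := by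
    have := partialL_zero_mem_bideg hx
    rw [show (2 : ℤ) - 1 = 1 by norm_num] at this
    exact add_mem this (partialL_one_mem_bideg hy)
  refine tr_eq_zero_of_mem_bideg_one hmem ?_
  obtain ⟨c, hc⟩ : ∃ c : ℝ, ∀ Y : ℕ → ℝ, ev 1 Y (u y : A) = c • (Y 0 - Y 1) ^ j :=
    ⟨_, ev_one_eq hy⟩
  have h1 : ev 1 (fun _ => (1 : ℝ)) (partialL 0 (u x : A)) = ev 2 (triple 1 1 0) (u x : A) := by
    rw [← ev_partialL_zero 1 rfl]
    exact ev_congr (fun i hi => by interval_cases i <;> rfl) _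
  -- The two halves of the divergence evaluate to c − c·0^j and c·0^j − c, so they cancel.
  have h2 := ev_apply_x_mul h 1 (triple (1 : ℝ) 1 0)
  have h3 := ev_partialL_one_mul 0 (fun _ => (1 : ℝ)) (u y : A)
  rw [hc, hc] at h2 h3
  rw [map_add, h1]
  simp [triple] at h2 h3 ⊢
  linarith

theorem hamDeriv_adX_mem_krvBideg (j : ℕ) : hamDeriv x (adX j) ∈ krvBideg 2 j := by
  have h : (x : A) * adX j ∈ bideg (2 : ℕ) j := by
    have := mul_mem_bideg ι_zero_mem_bideg (adX_mem_bideg j)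
    rwa [zero_add] at this
  have h' := hamDeriv_mem_derBideg h
  exact ⟨⟨hamDeriv_lie _ _, divergence_eq_zero_of_mem_derBideg_two h' (hamDeriv_lie _ _)⟩, h'⟩

theorem ev_one_hamDeriv_adX_y {j : ℕ} (hj : Even j) :
    ev 1 (Pi.single 0 (1 : ℝ)) (hamDeriv x (adX j) y : A) = -2 := by
  have hx : ((x : L) : A) = FreeAlgebra.ι ℝ 0 := rfl
  rw [coe_hamDeriv_y, map_neg, cycPartial_mul, map_add, ev_sandwich_adX, hx, sandwich_ι,
    if_pos rfl, ev_one_adX, ev_succ_ι_zero]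
  norm_num [hj.neg_one_pow]

theorem krvBideg_two_of_even {j : ℕ} (hj : Even j) :
    krvBideg 2 j = Submodule.span ℝ {hamDeriv x (adX j)} := by
  refine le_antisymm (fun u hu => ?_)
    ((Submodule.span_singleton_le_iff_mem _ _).2 (hamDeriv_adX_mem_krvBideg j))
  set c := ev 1 (Pi.single 0 (1 : ℝ)) (u y : A) with hc
  -- δ_j has coefficient −2 on ad_y^j(x), so adding c/2 times δ_j removes the coefficient c of u(y).
  have hv := add_mem hu (Submodule.smul_mem _ (c / 2) (hamDeriv_adX_mem_krvBideg j))
  have hvy := eq_smul_adX (mem_derBideg_iff.1 hv.2).2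
  have h0 : ev 1 (Pi.single 0 (1 : ℝ)) ((u + (c / 2) • hamDeriv x (adX j)) y : A) = 0 := by
    rw [LieDerivation.add_apply, LieDerivation.smul_apply, AddMemClass.coe_add, SetLike.val_smul,
      map_add, map_smul, ev_one_hamDeriv_adX_y hj, ← hc, smul_eq_mul]
    ring
  rw [h0, zero_smul] at hvy
  have h := eq_zero_of_apply_y_eq_zero two_ne_zero hv.2 hv.1.1 hvy
  rw [Submodule.mem_span_singleton]
  exact ⟨-(c / 2), by rw [neg_smul, eq_comm, ← add_eq_zero_iff_eq_neg, h]⟩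

theorem krvBideg_two_of_odd {j : ℕ} (hj : Odd j) : krvBideg 2 j = ⊥ := by
  refine (Submodule.eq_bot_iff _).2 fun u hu => ?_
  have hy := (mem_derBideg_iff.1 hu.2).2
  refine eq_zero_of_apply_y_eq_zero two_ne_zero hu.2 hu.1.1 ?_
  rw [Nat.cast_ofNat, show (2 : ℤ) - 1 = 1 by norm_num] at hy
  -- At (0, 1, 0) the factor Y₂ − Y₀ vanishes, which leaves c·(−1)^j = c.
  have h := ev_apply_x_mul hu.1.1 1 (fun i => if i = 1 then (1 : ℝ) else 0)
  have hc := ev_one_eq (R := ℝ) hy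
  set c := ev 1 (Pi.single 0 (1 : ℝ)) (u y : A)
  rw [hc, hc] at h
  simp [hj.neg_one_pow] at h
  rw [eq_smul_adX hy, show ev 1 (Pi.single 0 (1 : ℝ)) (u y : A) = 0 by linarith, zero_smul]

/-! ### Derivations of `x`-degree two -/

theorem map_triple {R S : Type} (f : R → S) (p q r : R) :
    (fun i => f (triple p q r i)) = triple (f p) (f q) (f r) := by
  funext i
  match i with
  | 0 => rfl
  | 1 => rfl
  | _ + 2 => rfl

theorem ev_two_eq_triple {R : Type} [CommRing R] [Algebra ℝ R] (Y : ℕ → R) (a : A) :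
    ev 2 Y a = ev 2 (triple (Y 0) (Y 1) (Y 2)) a :=
  ev_congr (fun i hi => by interval_cases i <;> rfl) a

section

variable {R : Type} [CommRing R] [Algebra ℝ R]

theorem ev_two_triple_neg {a : A} (ha : a ∈ freeLie) {p q r p' q' r' : R} (h : p - q = q' - r')
    (h' : q - r = p' - q') : ev 2 (triple p q r) a = -ev 2 (triple p' q' r') a :=
  ev_two_of_mem_freeLie ha h h'

theorem ev_two_triple_congr {a : A} (ha : a ∈ freeLie) {p q r p' q' r' : R} (h : p - q = p' - q')
    (h' : q - r = q' - r') : ev 2 (triple p q r) a = ev 2 (triple p' q' r') a :=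
  ev_two_congr_of_mem_freeLie ha h h'

theorem ev_two_triple_rotate {u : Der} (h : u ⁅x, y⁆ = 0) (p q r : R) :
    ev 2 (triple p q r) (u y : A) = ev 2 (triple q r p) (u y : A) := by
  -- Closing the sequence up with Y₃ = Y₀ kills the term containing u(x).
  let Y : ℕ → R
    | 0 => p
    | 1 => q
    | 2 => r
    | _ => p
  have := ev_apply_x_mul h 2 Y
  rw [ev_two_eq_triple, ev_two_eq_triple fun i => Y (i + 1),
    show Y (2 + 1) - Y 0 = 0 from sub_self p, mul_zero] at this
  exact sub_eq_zero.1 this.symm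

theorem ev_two_triple_swap {j : ℕ} {u : Der} (hu : u ∈ derBideg 3 j) (h : u ⁅x, y⁆ = 0) (p q : R) :
    ev 2 (triple q p 0) (u y : A) = -(-1) ^ j * ev 2 (triple p q 0) (u y : A) := by
  have hy : (u y : A) ∈ bideg 2 j := (mem_derBideg_iff.1 hu).2
  -- Antisymmetry leads to (p, p − q, 0); its negative has the same differences as (0, q, p), a
  -- rotation of (q, p, 0).
  have h1 : ev 2 (triple p q 0) (u y : A) = -ev 2 (triple p (p - q) 0) (u y : A) :=
    ev_two_triple_neg (u y).2 (by ring) (by ring)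
  have h2 := ev_smul_of_mem_bideg hy 2 (-1) (triple p (p - q) 0)
  rw [map_triple (fun c => -1 * c)] at h2
  rw [ev_two_triple_rotate h, ev_two_triple_rotate h, h1, neg_mul_neg, ← h2]
  exact ev_two_triple_congr (u y).2 (by ring) (by ring)

/-- The divergence of `u`, in the polynomial representation, in terms of `u(y)`. -/
theorem mul_ev_two_divergence {u : Der} (h : u ⁅x, y⁆ = 0) (p q : R) :
    p * ev 2 (alternate p q) (partialL 0 (u x : A) + partialL 1 (u y : A)) =
      ev 2 (triple q p 0) (u y : A) - ev 2 (triple p q 0) (u y : A) := by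
  -- The entries p, q, p are the cyclic specialisation, and the final 0 implements ∂^L_x. The value
  -- of u(y) at (p, q, p) occurs in both halves and cancels.
  let Y : ℕ → R
    | 0 => p
    | 1 => q
    | 2 => p
    | _ => 0
  have h1 : ev 2 (alternate p q) (partialL 0 (u x : A)) = ev 3 Y (u x : A) := by
    rw [← ev_partialL_zero 2 rfl]
    exact ev_congr (fun i hi => by interval_cases i <;> rfl) _
  have h2 := ev_apply_x_mul h 2 Y
  have h3 := ev_partialL_one_mul 1 (alternate p q) (u y : A)
  have e1 : ev 2 Y (u y : A) = ev 2 (alternate p q) (u y : A) :=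
    ev_congr (fun i hi => by interval_cases i <;> rfl) _
  have e2 : ev 2 (fun i => Y (i + 1)) (u y : A) = ev 2 (triple q p 0) (u y : A) :=
    ev_congr (fun i hi => by interval_cases i <;> rfl) _
  have e3 : ev 2 (Function.update (alternate p q) 2 0) (u y : A) =
      ev 2 (triple p q 0) (u y : A) :=
    ev_congr (fun i hi => by interval_cases i <;> rfl) _
  rw [e1, e2, show Y (2 + 1) - Y 0 = -p from zero_sub p] at h2
  rw [e3, show alternate p q (1 + 1) = p from rfl] at h3
  rw [map_add, h1]
  linear_combination -h2 + h3

end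

theorem divergence_eq_zero_of_odd {j : ℕ} (hj : Odd j) {u : Der} (hu : u ∈ derBideg 3 j)
    (h : u ⁅x, y⁆ = 0) : divergence u = 0 := by
  obtain ⟨hx, hy⟩ := mem_derBideg_iff.1 hu
  rw [Nat.cast_ofNat] at hx hy
  have hmem : partialL 0 (u x : A) + partialL 1 (u y : A) ∈ bideg 2 ((j : ℤ) - 1) := by
    have := partialL_zero_mem_bideg hx
    rw [show (3 : ℤ) - 1 = 2 by norm_num] at this hy
    exact add_mem this (partialL_one_mem_bideg hy)
  have h1 := mul_ev_two_divergence h (MvPolynomial.X 0 : MvPolynomial (Fin 2) ℝ) (MvPolynomial.X 1)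
  rw [ev_two_triple_swap hu h, hj.neg_one_pow, neg_neg, one_mul, sub_self] at h1
  rw [divergence, tr_eq_necklace_of_mem_bideg_two hmem,
    (mul_eq_zero.1 h1).resolve_left (MvPolynomial.X_ne_zero _), map_zero]

/-- By translation invariance the last variable may be taken to be zero. -/
theorem eq_zero_of_ev_two_eq_zero {b : L} {q : ℤ} (hb : (b : A) ∈ bideg 2 q)
    (h : ev 2 (triple (MvPolynomial.X 0) (MvPolynomial.X 1) (0 : MvPolynomial (Fin 2) ℝ))
      (b : A) = 0) : b = 0 := by
  refine Subtype.ext (eq_zero_of_ev_X_eq_zero (n := 2) hb ?_)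
  let φ : MvPolynomial (Fin 2) ℝ →ₐ[ℝ] MvPolynomial ℕ ℝ :=
    MvPolynomial.aeval ![MvPolynomial.X 0 - MvPolynomial.X 2, MvPolynomial.X 1 - MvPolynomial.X 2]
  have h' := congr_arg φ h
  rw [map_ev, map_triple φ, map_zero] at h'
  rw [← h', ev_two_eq_triple]
  exact ev_two_triple_congr b.2 (by simp [φ]) (by simp [φ])

theorem krvBideg_three_of_even {j : ℕ} (hj : Even j) : krvBideg 3 j = ⊥ := by
  refine (Submodule.eq_bot_iff _).2 fun u hu => ?_
  have hy := (mem_derBideg_iff.1 hu.2).2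
  refine eq_zero_of_apply_y_eq_zero three_ne_zero hu.2 hu.1.1 (eq_zero_of_ev_two_eq_zero hy ?_)
  let s : MvPolynomial (Fin 2) ℝ := MvPolynomial.X 0
  let t : MvPolynomial (Fin 2) ℝ := MvPolynomial.X 1
  have h1 := mul_ev_two_divergence hu.1.1 s t
  have h2 := mul_ev_two_divergence hu.1.1 t s
  have h3 := ev_two_alternate_eq_zero s t hu.1.2
  have h4 := ev_two_triple_swap hu.2 hu.1.1 s t
  rw [hj.neg_one_pow, neg_one_mul] at h4
  rw [h4] at h1 h2
  -- With f the value at (s, t, 0), the relations are s·D(s, t) = −2f, t·D(t, s) = 2f and D(s, t) +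
  -- D(t, s) = 0.
  have h5 : 2 * (s - t) * ev 2 (triple s t 0) (u y : A) = 0 := by
    linear_combination s * t * h3 - t * h1 - s * h2
  refine (mul_eq_zero.1 h5).resolve_left (mul_ne_zero two_ne_zero ?_)
  rw [sub_ne_zero, Ne, MvPolynomial.X_inj]
  decide

/-! ### The isomorphism of krv^{3,j} with the sign forms for odd j -/

theorem isHomogeneous_ev {σ : Type} {p : ℤ} {q : ℕ} {a : A} (ha : a ∈ bideg p q) (n : ℕ)
    {Y : ℕ → MvPolynomial σ ℝ} (hY : ∀ i, (Y i).IsHomogeneous 1) :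
    (ev n Y a).IsHomogeneous q := by
  refine map_mem_of_mem_bideg (ev n Y) (MvPolynomial.homogeneousSubmodule σ ℝ q)
    (fun w hp hq => ?_) ha
  obtain rfl : w.count 1 = q := by exact_mod_cast hq
  rw [MvPolynomial.mem_homogeneousSubmodule, ev_mono]
  clear hp hq ha
  induction w generalizing n Y with
  | nil =>
    rw [evWord_nil]
    split_ifs
    exacts [MvPolynomial.isHomogeneous_one _ _, MvPolynomial.isHomogeneous_zero _ _ _]
  | cons c w ih =>
    obtain rfl | rfl : c = 0 ∨ c = 1 := by omega
    · rw [List.count_cons_of_ne (by decide)]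
      cases n with
      | zero => rw [evWord_zero_zero_cons]; exact MvPolynomial.isHomogeneous_zero _ _ _
      | succ n => rw [evWord_succ_zero_cons]; exact ih n fun i => hY (i + 1)
    · rw [evWord_one_cons, List.count_cons_self, add_comm]
      exact (hY 0).mul (ih n hY)

/-- The sequence `s + t, t, 0, 0, …` of binary forms. -/
def formSeq : ℕ → MvPolynomial (Fin 2) ℝ :=
  triple (MvPolynomial.X 0 + MvPolynomial.X 1) (MvPolynomial.X 1) 0

theorem ev_formSeq_mem_signForms {j : ℕ} {u : Der} (hu : u ∈ derBideg 3 j) (h : u ⁅x, y⁆ = 0) :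
    ev 2 formSeq (u y : A) ∈ signForms j := by
  have hs := MvPolynomial.isHomogeneous_X (R := ℝ) (0 : Fin 2)
  have ht := MvPolynomial.isHomogeneous_X (R := ℝ) (1 : Fin 2)
  refine ⟨isHomogeneous_ev (mem_derBideg_iff.1 hu).2 2 fun i => ?_, ?_, ?_⟩
  · match i with
    | 0 => exact hs.add ht
    | 1 => exact ht
    | _ + 2 => exact MvPolynomial.isHomogeneous_zero _ _ _
  · rw [map_ev, formSeq, map_triple swapHom]
    refine ev_two_triple_neg (u y).2 ?_ ?_ <;>
    · simp only [map_add, map_zero, swapHom_X_zero, swapHom_X_one]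
      ring
  · rw [map_ev, formSeq, map_triple rotHom, ← ev_two_triple_rotate h]
    refine ev_two_triple_congr (u y).2 ?_ ?_ <;>
    · simp only [map_add, map_zero, rotHom_X_zero, rotHom_X_one]
      ring

/-- The binary form describing `u(y)` for a derivation `u` in `krv^{3,j}`. -/
def toSignForm (j : ℕ) : krvBideg 3 j →ₗ[ℝ] signForms j where
  toFun u := ⟨ev 2 formSeq ((u : Der) y : A), ev_formSeq_mem_signForms u.2.2 u.2.1.1⟩
  map_add' u v := Subtype.ext (map_add (ev 2 formSeq) ((u : Der) y : A) ((v : Der) y : A))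
  map_smul' c u := Subtype.ext (map_smul (ev 2 formSeq) c ((u : Der) y : A))

theorem toSignForm_injective (j : ℕ) : Function.Injective (toSignForm j) := by
  rw [injective_iff_map_eq_zero]
  intro u h
  have hy := (mem_derBideg_iff.1 u.2.2).2
  refine Subtype.ext (eq_zero_of_apply_y_eq_zero three_ne_zero u.2.2 u.2.1.1
    (eq_zero_of_ev_two_eq_zero hy ?_))
  -- The substitution s ↦ s − t turns (s + t, t, 0) into (s, t, 0).
  let φ : MvPolynomial (Fin 2) ℝ →ₐ[ℝ] MvPolynomial (Fin 2) ℝ :=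
    MvPolynomial.aeval ![MvPolynomial.X 0 - MvPolynomial.X 1, MvPolynomial.X 1]
  have h' := congr_arg φ (congr_arg Subtype.val h)
  change φ (ev 2 formSeq ((u : Der) y : A)) = φ 0 at h'
  rw [map_ev, formSeq, map_triple φ, map_zero] at h'
  simpa [φ] using h'

/-- The linear map sending `s ^ k * t ^ l` to `[ad_y^k (x), ad_y^l (x)]`. -/
def lieOfForm : MvPolynomial (Fin 2) ℝ →ₗ[ℝ] L :=
  (MvPolynomial.basisMonomials (Fin 2) ℝ).constr ℝ fun d => ⁅adX (d 0), adX (d 1)⁆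

theorem lieOfForm_monomial (d : Fin 2 →₀ ℕ) (c : ℝ) :
    lieOfForm (MvPolynomial.monomial d c) = c • ⁅adX (d 0), adX (d 1)⁆ := by
  have h : MvPolynomial.monomial d c = c • MvPolynomial.basisMonomials (Fin 2) ℝ d := by
    rw [MvPolynomial.coe_basisMonomials, MvPolynomial.smul_monomial, smul_eq_mul, mul_one]
  rw [h, map_smul, lieOfForm, Module.Basis.constr_basis]

theorem lieOfForm_mem_bideg {j : ℕ} {g : MvPolynomial (Fin 2) ℝ} (hg : g.IsHomogeneous j) :
    (lieOfForm g : A) ∈ bideg 2 j := by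
  suffices g ∈ (bideg 2 j).comap (freeLie.toSubmodule.subtype ∘ₗ lieOfForm) from this
  rw [g.as_sum]
  refine sum_mem fun d hd => ?_
  have hj := hg.degree_eq_sum_deg_support hd
  rw [← Finsupp.degree_apply, Finsupp.degree_eq_sum, Fin.sum_univ_two] at hj
  rw [Submodule.mem_comap, LinearMap.comp_apply, lieOfForm_monomial]
  refine Submodule.smul_mem _ _ ?_
  have := lie_mem_bideg (adX_mem_bideg (d 0)) (adX_mem_bideg (d 1))
  rwa [← Nat.cast_add, ← hj] at this

section

variable {R : Type} [CommRing R] [Algebra ℝ R]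

theorem aeval_vec_monomial (p q : R) (d : Fin 2 →₀ ℕ) :
    MvPolynomial.aeval ![p, q] (MvPolynomial.monomial d (1 : ℝ)) = p ^ d 0 * q ^ d 1 := by
  rw [MvPolynomial.aeval_monomial, map_one, one_mul, Finsupp.prod_fintype _ _ (by simp),
    Fin.prod_univ_two]
  rfl

theorem ev_two_lieOfForm (p q r : R) (g : MvPolynomial (Fin 2) ℝ) :
    ev 2 (triple p q r) (lieOfForm g : A) =
      MvPolynomial.aeval ![p - q, q - r] g - MvPolynomial.aeval ![q - r, p - q] g := by
  suffices ev 2 (triple p q r) ∘ₗ freeLie.toSubmodule.subtype ∘ₗ lieOfForm =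
      (MvPolynomial.aeval ![p - q, q - r]).toLinearMap -
        (MvPolynomial.aeval ![q - r, p - q]).toLinearMap from LinearMap.congr_fun this g
  refine (MvPolynomial.basisMonomials (Fin 2) ℝ).ext fun d => ?_
  rw [MvPolynomial.coe_basisMonomials, LinearMap.comp_apply, LinearMap.comp_apply,
    lieOfForm_monomial, one_smul]
  refine (ev_two_lie_adX _ _ _).trans ?_
  simp only [triple, LinearMap.sub_apply, AlgHom.toLinearMap_apply, aeval_vec_monomial]
  ring

theorem ev_two_sandwich_lieOfForm (p q r : R) (g : MvPolynomial (Fin 2) ℝ) :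
    ev 2 (triple p q r) (sandwich 0 (lieOfForm g : A) (FreeAlgebra.ι ℝ 0)) =
      MvPolynomial.aeval ![r - p, p - q] g - MvPolynomial.aeval ![r - p, q - r] g +
        MvPolynomial.aeval ![q - r, r - p] g - MvPolynomial.aeval ![p - q, r - p] g := by
  suffices ev 2 (triple p q r) ∘ₗ (sandwich 0).flip (FreeAlgebra.ι ℝ 0) ∘ₗ
      freeLie.toSubmodule.subtype ∘ₗ lieOfForm =
      (MvPolynomial.aeval ![r - p, p - q]).toLinearMap -
        (MvPolynomial.aeval ![r - p, q - r]).toLinearMap +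
        (MvPolynomial.aeval ![q - r, r - p]).toLinearMap -
        (MvPolynomial.aeval ![p - q, r - p]).toLinearMap from LinearMap.congr_fun this g
  refine (MvPolynomial.basisMonomials (Fin 2) ℝ).ext fun d => ?_
  rw [MvPolynomial.coe_basisMonomials, LinearMap.comp_apply, LinearMap.comp_apply,
    LinearMap.comp_apply, lieOfForm_monomial, one_smul, LinearMap.flip_apply]
  change ev 2 (triple p q r) (sandwich 0 ⁅(adX (d 0) : A), (adX (d 1) : A)⁆ _) = _
  rw [sandwich_lie, map_add, ev_sandwich_adX, ev_sandwich_adX, ev_lie_swap, ev_succ_lie_ι_zero,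
    ev_succ_lie_ι_zero, ev_one_adX, ev_one_adX, ev_one_adX, ev_one_adX]
  simp only [triple, LinearMap.sub_apply, LinearMap.add_apply, AlgHom.toLinearMap_apply,
    aeval_vec_monomial]
  ring

end

theorem toSignForm_surjective {j : ℕ} (hj : Odd j) : Function.Surjective (toSignForm j) := by
  rintro ⟨g, hg⟩
  obtain ⟨h1, h2, h3⟩ := mem_signForms.1 hg
  have hmem : (x : A) * lieOfForm g ∈ bideg (3 : ℕ) j := by
    have := mul_mem_bideg ι_zero_mem_bideg (lieOfForm_mem_bideg h1)
    rwa [zero_add] at this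
  have hd := hamDeriv_mem_derBideg hmem
  have hl := hamDeriv_lie x (lieOfForm g)
  let u : krvBideg 3 j := ⟨hamDeriv x (lieOfForm g), ⟨hl, divergence_eq_zero_of_odd hj hd hl⟩, hd⟩
  let s : MvPolynomial (Fin 2) ℝ := MvPolynomial.X 0
  let t : MvPolynomial (Fin 2) ℝ := MvPolynomial.X 1
  have hst : MvPolynomial.aeval ![s, t] g = g := by
    have : MvPolynomial.aeval ![s, t] = AlgHom.id ℝ (MvPolynomial (Fin 2) ℝ) := by
      ext i; fin_cases i <;> simp [s, t]
    rw [this, AlgHom.id_apply]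
  have hts : MvPolynomial.aeval ![t, s] g = -g := h2
  have hrot (p q φ : MvPolynomial (Fin 2) ℝ)
      (hφ : MvPolynomial.aeval ![p, q] g = φ) :
      MvPolynomial.aeval ![rotHom p, rotHom q] g = rotHom φ := by
    have : MvPolynomial.aeval ![rotHom p, rotHom q] = rotHom.comp (MvPolynomial.aeval ![p, q]) := by
      ext i; fin_cases i <;> simp
    rw [this, AlgHom.comp_apply, hφ]
  have e0 : rotHom s = t := rotHom_X_zero
  have e1 : rotHom t = -s - t := rotHom_X_one
  have e2 : rotHom (-s - t) = s := by rw [map_sub, map_neg, e0, e1]; ring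
  have f1 := hrot _ _ _ hst
  have f2 := hrot _ _ _ f1
  have k1 := hrot _ _ _ hts
  have k2 := hrot _ _ _ k1
  simp only [e0, e1, e2, map_neg, h3] at f1 f2 k1 k2
  have hx : ((x : L) : A) = FreeAlgebra.ι ℝ 0 := rfl
  -- `lieOfForm g` antisymmetrises g and contributes 2g; each of the four terms from the cyclic
  -- derivative inside `lieOfForm g` contributes g by S₃-equivariance. The sign in u(y) = −∂_x gives
  -- −6g.
  have key : ev 2 formSeq (hamDeriv x (lieOfForm g) y : A) = (-6 : ℝ) • g := by
    rw [coe_hamDeriv_y, map_neg, cycPartial_mul, map_add, hx, sandwich_ι, if_pos rfl, formSeq,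
      ev_two_lieOfForm, ev_two_sandwich_lieOfForm]
    change -(MvPolynomial.aeval ![s + t - t, t - 0] g - MvPolynomial.aeval ![t - 0, s + t - t] g +
      (MvPolynomial.aeval ![0 - (s + t), s + t - t] g - MvPolynomial.aeval ![0 - (s + t), t - 0] g +
        MvPolynomial.aeval ![t - 0, 0 - (s + t)] g -
        MvPolynomial.aeval ![s + t - t, 0 - (s + t)] g)) = _
    rw [add_sub_cancel_right, sub_zero, show 0 - (s + t) = -s - t by ring, hst, hts, f1, f2, k1, k2]
    module
  refine ⟨(-6 : ℝ)⁻¹ • u, Subtype.ext ?_⟩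
  rw [map_smul]
  change (-6 : ℝ)⁻¹ • ev 2 formSeq (hamDeriv x (lieOfForm g) y : A) = g
  rw [key, inv_smul_smul₀ (by norm_num)]

end EllipticKV

end

/-! ### The main theorem -/

theorem mainTheorem1 (j : ℕ) :
    (Even j → ∃ δ : EllipticKV.Der, EllipticKV.IsDerivationOfTree (EllipticKV.deltaTree j) δ ∧
      δ ≠ 0 ∧ EllipticKV.krvBideg 2 j = Submodule.span ℝ {δ}) ∧
    (Odd j → EllipticKV.krvBideg 2 j = ⊥) ∧
    (Even j → EllipticKV.krvBideg 3 j = ⊥) ∧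
    (Odd j → Module.Finite ℝ (EllipticKV.krvBideg 3 j) ∧
      (Module.finrank ℝ (EllipticKV.krvBideg 3 j) : ℤ) =
        ⌊((j : ℚ) - 1) / 2⌋ - ⌊((j : ℚ) - 1) / 3⌋) := by
  refine ⟨fun hj => ⟨EllipticKV.hamDeriv EllipticKV.x (EllipticKV.adX j),
    EllipticKV.isDerivationOfTree_hamDeriv _ _, fun h => ?_, EllipticKV.krvBideg_two_of_even hj⟩,
    EllipticKV.krvBideg_two_of_odd, EllipticKV.krvBideg_three_of_even, fun hj => ?_⟩
  · have h1 := EllipticKV.ev_one_hamDeriv_adX_y hj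
    rw [h, LieDerivation.zero_apply, ZeroMemClass.coe_zero, map_zero] at h1
    norm_num at h1
  · let e := LinearEquiv.ofBijective (EllipticKV.toSignForm j)
      ⟨EllipticKV.toSignForm_injective j, EllipticKV.toSignForm_surjective hj⟩
    exact ⟨Module.Finite.equiv e.symm,
      by rw [e.finrank_eq, EllipticKV.finrank_signForms_of_odd hj]⟩
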